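/- Let $m,k\ge 0$ be integers, and for each time $i$ let $o_i\ge 0$ be the dimension of the observation. Let $x_{\mathrm b}\in\mathbb R^m$, let $B\in\mathbb R^{m\times m}$ be symmetric positive semidefinite, and for $i=1,\dots,k$ let $M_i\in\mathbb R^{m\times m}$, $\mu_i\in\mathbb R^m$, $H_i\in\mathbb R^{o_i\times m}$, $Q_i\in\mathbb R^{m\times m}$ symmetric positive semidefinite, $R_i\in\mathbb R^{o_i\times o_i}$ symmetric positive definite, and $y_i\in\mathbb R^{o_i}$ a given (deterministic) data vector. For composite vectors $x_{0:i}=[x_0;\dots;x_i]\in(\mathbb R^m)^{i+1}$ put $\tilde H_i=[0,\dots,0,H_i]$, so that $\tilde H_i x_{0:i}=H_ix_i$, and let $F_i=\begin{bmatrix} I\\ 0\ \cdots\ 0\ M_i\end{bmatrix}$, so that $F_ix_{0:i-1}=[x_{0:i-1};M_ix_{i-1}]$. For a matrix $P$ put $K_i(P)=P\tilde H_i^{\mathrm T}(\tilde H_iP\tilde H_i^{\mathrm T}+R_i)^{-1}$. On one probability space let $X_0^n\sim N(x_{\mathrm b},B)$, $V_i^n\sim N(0,Q_i)$, $W_i^n\sim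 N(0,R_i)$ ($n=1,2,\dots$; $i=1,\dots,k$) be mutually independent random vectors. *EnKS with $N$ members.* $X_{0:0|0}^n=X_0^n$ for $n=1,\dots,N$. For $i=1,\dots,k$, $$X_{0:i|i-1}^n=\begin{bmatrix}X_{0:i-1|i-1}^n\\ M_iX_{i-1|i-1}^n+\mu_i+V_i^n\end{bmatrix},\qquad X_{0:i|i}^n=X_{0:i|i-1}^n+K_i(P_{0:i|i-1}^N)\,(y_i-W_i^n-H_iX_{i|i-1}^n),$$ where $P_{0:i|i-1}^N$ is the sample covariance (normalized by $1/(N-1)$) of $X_{0:i|i-1}^1,\dots,X_{0:i|i-1}^N$. *Reference ensemble.* $U_{0:i|i}^n$, $n=1,2,\dots$, is defined by the same recursion from the same $X_0^n,V_i^n,W_i^n$, with $P_{0:i|i-1}^N$ replaced by the exact covariance matrix of $U_{0:i|i-1}^1$. *Kalman smoother.* $X_{0:0|0}=x_{\mathrm b}$, $P_{0:0|0}=B$, and for $i=1,\dots,k$, with $P_{0:i|i-1}=F_iP_{0:i-1|i-1}F_i^{\mathrm T}+\begin{bmatrix}0&0\\0&Q_i\end{bmatrix}$, $X_{0:i|i-1}=F_iX_{0:i-1|i-1}+[0;\mu_i]$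 and $K_i=K_i(P_{0:i|i-1})$, $$X_{0:i|i}=X_{0:i|i-1}+K_i(y_i-\tilde H_iX_{0:i|i-1}),\qquad P_{0:i|i}=(I-K_i\tilde H_i)P_{0:i|i-1}.$$ **Theorem.** Fix $i\in\{0,\dots,k\}$. For every $N\ge 2$, the columns of the random matrix $$\begin{bmatrix}X_{0:i|i}^1,\dots,X_{0:i|i}^N\\ U_{0:i|i}^1,\dots,U_{0:i|i}^N\end{bmatrix}$$ are exchangeable, i.e. their joint distribution is invariant under permutations of the columns. With $\bar X_{0:i|i}^N$ and $P_{0:i|i}^N$ ($N\ge2$) the sample mean and the sample covariance of $X_{0:i|i}^1,\dots,X_{0:i|i}^N$, as $N\to\infty$, $$X_{0:i|i}^1\to U_{0:i|i}^1,\qquad \bar X_{0:i|i}^N\to E(U_{0:i|i}^1)=X_{0:i|i},\qquad P_{0:i|i}^N\to \operatorname{Cov}(U_{0:i|i}^1)=P_{0:i|i}$$ in $L^p$ for every $1\le p<\infty$ (all these random elements being in every such $L^p$, with the Euclidean norm for vectors and the spectral norm for matrices). -/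

import Mathlib

open MeasureTheory ProbabilityTheory Filter Topology
open scoped ENNReal Matrix Matrix.Norms.L2Operator

noncomputable section

/-! ### The linear Gaussian system -/

/-- Data of the linear Gaussian state space system with state dimension `m` and observation
dimension `o i` at time `i`:
`X₀ ∼ N(xb, B)`, `Xᵢ = Mᵢ Xᵢ₋₁ + shiftᵢ + Vᵢ`, `Vᵢ ∼ N(0, Qᵢ)`, `yᵢ = Hᵢ Xᵢ + Wᵢ`, `Wᵢ ∼ N(0, Rᵢ)`.
The vectors `y i` are the given observed data. Only the times `i ≥ 1` of the sequences are used. -/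
structure LinearSystem (m : ℕ) (o : ℕ → ℕ) where
  xb : EuclideanSpace ℝ (Fin m)
  B : Matrix (Fin m) (Fin m) ℝ
  M : ℕ → Matrix (Fin m) (Fin m) ℝ
  shift : ℕ → EuclideanSpace ℝ (Fin m)
  Q : ℕ → Matrix (Fin m) (Fin m) ℝ
  H : ∀ i, Matrix (Fin (o i)) (Fin m) ℝ
  R : ∀ i, Matrix (Fin (o i)) (Fin (o i)) ℝ
  y : ∀ i, EuclideanSpace ℝ (Fin (o i))

/-- Composite states `x_{0:i} = [x₀; …; xᵢ]` with the Euclidean norm; the entry `(j, a)` is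
coordinate `a` of the state at time `j`. -/
abbrev Composite (m i : ℕ) : Type := EuclideanSpace ℝ (Fin (i + 1) × Fin m)

/-- The composite state at time `0` is the state at time `0`. -/
def compositeZero {m : ℕ} (x : EuclideanSpace ℝ (Fin m)) : Composite m 0 :=
  WithLp.toLp 2 fun a => x a.2

namespace LinearSystem

variable {m : ℕ} {o : ℕ → ℕ} (S : LinearSystem m o)

/-- The block matrix `[I; 0 … 0 M_{i+1}]` which sends `x_{0:i}` to `[x_{0:i}; M_{i+1} xᵢ]`. -/
def modelMatrix (i : ℕ) : Matrix (Fin (i + 2) × Fin m) (Fin (i + 1) × Fin m) ℝ :=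
  Matrix.of fun r c =>
    if r.1 = Fin.last (i + 1) then (if c.1 = Fin.last i then S.M (i + 1) r.2 c.2 else 0)
    else (if r.1 = c.1.castSucc ∧ r.2 = c.2 then 1 else 0)

/-- The block matrix `[0; …; 0; I]` which places a vector in the last (time `i`) block. -/
def lastBlock (m i : ℕ) : Matrix (Fin (i + 1) × Fin m) (Fin m) ℝ :=
  Matrix.of fun r b => if r.1 = Fin.last i ∧ r.2 = b then 1 else 0

/-- The observation matrix `H̃ᵢ = [0, …, 0, Hᵢ]` of the composite state. -/
def obsMatrix (i : ℕ) : Matrix (Fin (o i)) (Fin (i + 1) × Fin m) ℝ :=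
  Matrix.of fun a c => if c.1 = Fin.last i then S.H i a c.2 else 0

/-- Advance in time: `x_{0:i}` becomes `[x_{0:i}; M_{i+1} xᵢ + shift_{i+1} + v]`. -/
def advance (i : ℕ) (x : Composite m i) (v : EuclideanSpace ℝ (Fin m)) : Composite m (i + 1) :=
  (S.modelMatrix i).toEuclideanLin x +
    (lastBlock m (i + 1)).toEuclideanLin (S.shift (i + 1) + v)

/-- The gain `P H̃ᵢᵀ (H̃ᵢ P H̃ᵢᵀ + Rᵢ)⁻¹` for a forecast covariance `P`. -/
def gain (i : ℕ) (P : Matrix (Fin (i + 1) × Fin m) (Fin (i + 1) × Fin m) ℝ) :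
    Matrix (Fin (i + 1) × Fin m) (Fin (o i)) ℝ :=
  P * (S.obsMatrix i)ᵀ * (S.obsMatrix i * P * (S.obsMatrix i)ᵀ + S.R i)⁻¹

/-- Analysis step with forecast covariance `P`, for the forecast `x` and the perturbation `w`:
`x + P H̃ᵢᵀ (H̃ᵢ P H̃ᵢᵀ + Rᵢ)⁻¹ (yᵢ - w - H̃ᵢ x)`. -/
def analysis (i : ℕ) (P : Matrix (Fin (i + 1) × Fin m) (Fin (i + 1) × Fin m) ℝ)
    (x : Composite m i) (w : EuclideanSpace ℝ (Fin (o i))) : Composite m i :=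
  x + (S.gain i P).toEuclideanLin (S.y i - w - (S.obsMatrix i).toEuclideanLin x)

/-! ### The Kalman smoother -/

/-- The forecast covariance `P_{0:i+1|i}` obtained from `P = P_{0:i|i}`. -/
def smootherForecastCov (i : ℕ) (P : Matrix (Fin (i + 1) × Fin m) (Fin (i + 1) × Fin m) ℝ) :
    Matrix (Fin (i + 2) × Fin m) (Fin (i + 2) × Fin m) ℝ :=
  S.modelMatrix i * P * (S.modelMatrix i)ᵀ +
    lastBlock m (i + 1) * S.Q (i + 1) * (lastBlock m (i + 1))ᵀ

/-- The Kalman smoother covariance `P_{0:i|i}`. -/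
def smootherCov : (i : ℕ) → Matrix (Fin (i + 1) × Fin m) (Fin (i + 1) × Fin m) ℝ
  | 0 => Matrix.of fun r c => S.B r.2 c.2
  | i + 1 =>
    let P := S.smootherForecastCov i (smootherCov i)
    (1 - S.gain (i + 1) P * S.obsMatrix (i + 1)) * P

/-- The Kalman smoother mean `X_{0:i|i}`. -/
def smootherMean : (i : ℕ) → Composite m i
  | 0 => compositeZero S.xb
  | i + 1 =>
    let P := S.smootherForecastCov i (S.smootherCov i)
    S.analysis (i + 1) P (S.advance i (smootherMean i) 0) 0

end LinearSystem

/-! ### Sample and exact moments -/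

/-- The sample mean of an ensemble of size `N`. -/
def sampleMean {ι : Type*} {N : ℕ} (E : Fin N → EuclideanSpace ℝ ι) : EuclideanSpace ℝ ι :=
  (N : ℝ)⁻¹ • ∑ n, E n

/-- The sample covariance `(N - 1)⁻¹ ∑ₙ (Eⁿ - Ē) (Eⁿ - Ē)ᵀ` of an ensemble of size `N`. -/
def sampleCov {ι : Type*} {N : ℕ} (E : Fin N → EuclideanSpace ℝ ι) : Matrix ι ι ℝ :=
  ((N : ℝ) - 1)⁻¹ •
    ∑ n, Matrix.vecMulVec (E n - sampleMean E).ofLp (E n - sampleMean E).ofLp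

/-- The covariance matrix `E[(Y - E Y) (Y - E Y)ᵀ]` of a random vector. -/
def covarianceMatrix {Ω : Type*} [MeasurableSpace Ω] (Pr : Measure Ω) {ι : Type*}
    (Y : Ω → EuclideanSpace ℝ ι) : Matrix ι ι ℝ :=
  Matrix.of fun a b => cov[fun ω => Y ω a, fun ω => Y ω b; Pr]

/-! ### The random inputs -/

/-- The simulated random vectors: `init n` is the initial member `n`, and `model i n` and `obs i n`
are the perturbations `Vᵢⁿ` and `Wᵢⁿ` of member `n` at time `i`. Members are numbered from `0`. -/
structure RandomInputs (Ω : Type*) (m : ℕ) (o : ℕ → ℕ) where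
  init : ℕ → Ω → EuclideanSpace ℝ (Fin m)
  model : ℕ → ℕ → Ω → EuclideanSpace ℝ (Fin m)
  obs : ∀ i, ℕ → Ω → EuclideanSpace ℝ (Fin (o i))

/-- Labels of the random inputs up to time `k`; the label `i : Fin k` stands for time `i + 1`. -/
inductive InputIndex (k : ℕ) : Type
  | init (n : ℕ) : InputIndex k
  | model (i : Fin k) (n : ℕ) : InputIndex k
  | obs (i : Fin k) (n : ℕ) : InputIndex k

/-- The dimension of the random input with a given label. -/
def InputIndex.dim (m : ℕ) (o : ℕ → ℕ) {k : ℕ} : InputIndex k → ℕ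
  | .init _ => m
  | .model _ _ => m
  | .obs i _ => o (i + 1)

/-- All random inputs up to time `k`, as one family. -/
def RandomInputs.family {Ω : Type*} {m : ℕ} {o : ℕ → ℕ} (ξ : RandomInputs Ω m o) (k : ℕ) :
    (j : InputIndex k) → Ω → EuclideanSpace ℝ (Fin (j.dim m o))
  | .init n => ξ.init n
  | .model i n => ξ.model (i + 1) n
  | .obs i n => ξ.obs (i + 1) n

/-- The random inputs up to time `k` are mutually independent, the initial members are
`N(xb, B)`, and the perturbations at the times `1, …, k` are `N(0, Qᵢ)` and `N(0, Rᵢ)`. -/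
structure RandomInputs.IsSampleOf {Ω : Type*} [MeasurableSpace Ω] {m : ℕ} {o : ℕ → ℕ}
    (ξ : RandomInputs Ω m o) (S : LinearSystem m o) (k : ℕ) (Pr : Measure Ω) : Prop where
  indep : iIndepFun (ξ.family k) Pr
  law_init : ∀ n, HasLaw (ξ.init n) (multivariateGaussian S.xb S.B) Pr
  law_model : ∀ i, 1 ≤ i → i ≤ k → ∀ n,
    HasLaw (ξ.model i n) (multivariateGaussian 0 (S.Q i)) Pr
  law_obs : ∀ i, 1 ≤ i → i ≤ k → ∀ n,
    HasLaw (ξ.obs i n) (multivariateGaussian 0 (S.R i)) Pr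

/-! ### The ensembles -/

/-- The ensemble Kalman smoother with `N` members: `enks S ξ N i ω n` is the value at `ω` of
member `n` of the analysis ensemble `X_{0:i|i}`. -/
def enks {Ω : Type*} {m : ℕ} {o : ℕ → ℕ} (S : LinearSystem m o) (ξ : RandomInputs Ω m o) (N : ℕ) :
    (i : ℕ) → Ω → Fin N → Composite m i
  | 0, ω => fun n => compositeZero (ξ.init n ω)
  | i + 1, ω =>
    let forecast : Fin N → Composite m (i + 1) :=
      fun n => S.advance i (enks S ξ N i ω n) (ξ.model (i + 1) n ω)
    fun n => S.analysis (i + 1) (sampleCov forecast) (forecast n) (ξ.obs (i + 1) n ω)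

/-- The reference ensemble: `refEnsemble S ξ Pr i n` is member `n` of `U_{0:i|i}`, built like the
ensemble Kalman smoother from the same random inputs, but with the exact covariance of the
forecast member `U_{0:i|i-1}¹` in place of the sample covariance. -/
def refEnsemble {Ω : Type*} [MeasurableSpace Ω] {m : ℕ} {o : ℕ → ℕ} (S : LinearSystem m o)
    (ξ : RandomInputs Ω m o) (Pr : Measure Ω) : (i : ℕ) → ℕ → Ω → Composite m i
  | 0 => fun n ω => compositeZero (ξ.init n ω)
  | i + 1 =>
    let forecast : ℕ → Ω → Composite m (i + 1) :=
      fun n ω => S.advance i (refEnsemble S ξ Pr i n ω) (ξ.model (i + 1) n ω)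
    fun n ω =>
      S.analysis (i + 1) (covarianceMatrix Pr (forecast 0)) (forecast n ω) (ξ.obs (i + 1) n ω)

/-! ### Exchangeability and convergence in all `L^p` -/

/-- Random elements `Y¹, …, Y^N` are exchangeable: they are measurable and their joint distribution
is invariant under permutations of the indices. -/
def Exchangeable {Ω : Type*} [MeasurableSpace Ω] {E : Type*} [MeasurableSpace E] {N : ℕ}
    (Y : Fin N → Ω → E) (Pr : Measure Ω) : Prop :=
  ∀ π : Equiv.Perm (Fin N), IdentDistrib (fun ω n => Y (π n) ω) (fun ω n => Y n ω) Pr Pr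

/-- `Y_N → Z` in `L^p` for every `1 ≤ p < ∞`, all the elements being in `L^p`. -/
def TendstoInAllLp {Ω : Type*} [MeasurableSpace Ω] {E : Type*} [NormedAddCommGroup E]
    (Y : ℕ → Ω → E) (Z : Ω → E) (Pr : Measure Ω) : Prop :=
  ∀ p : ℝ≥0∞, 1 ≤ p → p ≠ ∞ →
    (∀ N, MemLp (Y N) p Pr) ∧ MemLp Z p Pr ∧
      Tendsto (fun N => eLpNorm (fun ω => Y N ω - Z ω) p Pr) atTop (𝓝 0)

end

/-! The gains of the reference ensemble are deterministic, so its members are independent and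
identically distributed, and each is obtained from its own Gaussian inputs by affine maps. Hence
they lie in every L^p, and their mean and covariance follow the Kalman smoother recursion
(`moments_refEnsemble`); only the first two moments of the inputs enter there, together with the
identity `analysisCov_eq` for the optimal gain.

The members of the smoother are coupled through the sample covariance, but symmetrically: permuting
the inputs preserves their joint law and permutes the members. This gives exchangeability, so every
pair (Xⁿ, Uⁿ) has the law of the first pair. By Minkowski, an average of f(Xⁿ) - f(Uⁿ) therefore has
L^p norm at most that of f(X¹) - f(U¹), while the averages of f(Uⁿ) obey the L^p law of large
numbers (`TendstoInAllLp.average`). With f a coordinate or a product of two, convergence of the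
first member alone yields convergence of sample means and covariances.

Convergence of the first member is an induction on time (`tendsto_enks`). The forecast is affine.
The gain is globally Lipschitz at a fixed covariance on the positive semidefinite cone, because R
bounds (HPHᵀ + R)⁻¹ uniformly in P (`exists_norm_gain_sub_le`), so gains converge with the sample
covariances. The correction is bilinear in gain and innovation. Hölder costs a doubling of the
exponent, so the induction must carry all p at once (`bilin`). -/

/-! ### Calculus of convergence in all L^p. -/

namespace TendstoInAllLp

variable {Ω : Type*} [MeasurableSpace Ω] {Pr : Measure Ω}
  {E F G : Type*} [NormedAddCommGroup E] [NormedAddCommGroup F] [NormedAddCommGroup G]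

theorem memLp {Y : ℕ → Ω → E} {Z : Ω → E} (h : TendstoInAllLp Y Z Pr) (N : ℕ) {p : ℝ≥0∞}
    (hp : 1 ≤ p) (hp' : p ≠ ∞) : MemLp (Y N) p Pr := (h p hp hp').1 N

theorem memLp_limit {Y : ℕ → Ω → E} {Z : Ω → E} (h : TendstoInAllLp Y Z Pr) {p : ℝ≥0∞}
    (hp : 1 ≤ p) (hp' : p ≠ ∞) : MemLp Z p Pr := (h p hp hp').2.1

/-- A sequence converges if the differences to the limit are dominated by a null sequence. -/
theorem of_eLpNorm_le {Y : ℕ → Ω → E} {Z : Ω → E}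
    (hY : ∀ N, AEStronglyMeasurable (Y N) Pr)
    (hZ : ∀ p : ℝ≥0∞, 1 ≤ p → p ≠ ∞ → MemLp Z p Pr)
    (h : ∀ p : ℝ≥0∞, 1 ≤ p → p ≠ ∞ → ∃ g : ℕ → ℝ≥0∞, (∀ N, g N ≠ ∞) ∧
      Tendsto g atTop (𝓝 0) ∧ ∀ N, eLpNorm (fun ω => Y N ω - Z ω) p Pr ≤ g N) :
    TendstoInAllLp Y Z Pr := by
  intro p hp hp'
  obtain ⟨g, hg, hg0, hle⟩ := h p hp hp'
  refine ⟨fun N => ?_, hZ p hp hp', ?_⟩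
  · have hd : MemLp (fun ω => Y N ω - Z ω) p Pr :=
      ⟨(hY N).sub (hZ p hp hp').1, (hle N).trans_lt (hg N).lt_top⟩
    have := hd.add (hZ p hp hp')
    refine (memLp_congr_ae (ae_of_all _ fun ω => ?_)).1 this
    simp
  · exact tendsto_of_tendsto_of_tendsto_of_le_of_le tendsto_const_nhds hg0 (fun _ => zero_le) hle

theorem const {Z : Ω → E} (hZ : ∀ p : ℝ≥0∞, 1 ≤ p → p ≠ ∞ → MemLp Z p Pr) :
    TendstoInAllLp (fun _ => Z) Z Pr := by
  intro p hp hp'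
  refine ⟨fun _ => hZ p hp hp', hZ p hp hp', ?_⟩
  simp

theorem eLpNorm_ne_top {Y : ℕ → Ω → E} {Z : Ω → E} (h : TendstoInAllLp Y Z Pr) {p : ℝ≥0∞}
    (hp : 1 ≤ p) (hp' : p ≠ ∞) (N : ℕ) : eLpNorm (fun ω => Y N ω - Z ω) p Pr ≠ ∞ :=
  ((h.memLp N hp hp').sub (h.memLp_limit hp hp')).2.ne

theorem add {Y Y' : ℕ → Ω → E} {Z Z' : Ω → E} (h : TendstoInAllLp Y Z Pr)
    (h' : TendstoInAllLp Y' Z' Pr) :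
    TendstoInAllLp (fun N ω => Y N ω + Y' N ω) (fun ω => Z ω + Z' ω) Pr := by
  refine of_eLpNorm_le
    (fun N => (h.memLp N le_rfl ENNReal.one_ne_top).1.add (h'.memLp N le_rfl ENNReal.one_ne_top).1)
    (fun p hp hp' => (h.memLp_limit hp hp').add (h'.memLp_limit hp hp')) fun p hp hp' =>
    ⟨fun N => eLpNorm (fun ω => Y N ω - Z ω) p Pr + eLpNorm (fun ω => Y' N ω - Z' ω) p Pr,
      fun N => ENNReal.add_ne_top.2 ⟨h.eLpNorm_ne_top hp hp' N, h'.eLpNorm_ne_top hp hp' N⟩, ?_,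
      fun N => ?_⟩
  · simpa using (h p hp hp').2.2.add (h' p hp hp').2.2
  · refine le_trans (le_of_eq ?_) (eLpNorm_add_le
      ((h.memLp N hp hp').sub (h.memLp_limit hp hp')).1
      ((h'.memLp N hp hp').sub (h'.memLp_limit hp hp')).1 hp)
    congr 1
    ext ω
    simp only [Pi.add_apply]
    abel

/-- Composition with a map which is Lipschitz at the values of the limit. -/
theorem comp_of_norm_sub_le {Y : ℕ → Ω → E} {Z : Ω → E} (h : TendstoInAllLp Y Z Pr) {f : E → F}
    {C : ℝ} (hm : ∀ N, AEStronglyMeasurable (fun ω => f (Y N ω)) Pr)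
    (hZ : ∀ p : ℝ≥0∞, 1 ≤ p → p ≠ ∞ → MemLp (fun ω => f (Z ω)) p Pr)
    (hC : ∀ N ω, ‖f (Y N ω) - f (Z ω)‖ ≤ C * ‖Y N ω - Z ω‖) :
    TendstoInAllLp (fun N ω => f (Y N ω)) (fun ω => f (Z ω)) Pr := by
  refine of_eLpNorm_le hm hZ fun p hp hp' =>
    ⟨fun N => ENNReal.ofReal C * eLpNorm (fun ω => Y N ω - Z ω) p Pr,
      fun N => ENNReal.mul_ne_top ENNReal.ofReal_ne_top (h.eLpNorm_ne_top hp hp' N), ?_,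
      fun N => eLpNorm_le_mul_eLpNorm_of_ae_le_mul (ae_of_all _ (hC N)) p⟩
  simpa using ENNReal.Tendsto.const_mul (h p hp hp').2.2 (Or.inr ENNReal.ofReal_ne_top)

theorem finset_sum {ι : Type*} {s : Finset ι} {Y : ι → ℕ → Ω → E} {Z : ι → Ω → E}
    (h : ∀ j ∈ s, TendstoInAllLp (Y j) (Z j) Pr) :
    TendstoInAllLp (fun N ω => ∑ j ∈ s, Y j N ω) (fun ω => ∑ j ∈ s, Z j ω) Pr := by
  classical
  induction s using Finset.induction_on with
  | empty => simpa using const (Pr := Pr) (Z := fun _ : Ω => (0 : E)) fun p _ _ => MemLp.zero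
  | insert a s ha ih =>
    simp only [Finset.sum_insert ha]
    exact (h a (Finset.mem_insert_self a s)).add
      (ih fun j hj => h j (Finset.mem_insert_of_mem hj))

theorem of_tendsto [IsFiniteMeasure Pr] {c : ℕ → E} {d : E} (h : Tendsto c atTop (𝓝 d)) :
    TendstoInAllLp (fun N _ => c N) (fun _ => d) Pr := by
  intro p hp hp'
  refine ⟨fun N => memLp_const _, memLp_const _, ?_⟩
  have hp0 : p ≠ 0 := (zero_lt_one.trans_le hp).ne'
  simp only [eLpNorm_const' _ hp0 hp']
  have h0 : Tendsto (fun N => ‖c N - d‖ₑ) atTop (𝓝 0) := by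
    rw [← tendsto_iff_enorm_sub_tendsto_zero]
    exact h
  have hm : Pr Set.univ ^ (1 / p.toReal) ≠ ∞ := by finiteness
  simpa using ENNReal.Tendsto.mul_const h0 (Or.inr hm)

theorem congr_ae {Y Y' : ℕ → Ω → E} {Z Z' : Ω → E} (h : TendstoInAllLp Y Z Pr)
    (hY : ∀ N, Y N =ᵐ[Pr] Y' N) (hZ : Z =ᵐ[Pr] Z') : TendstoInAllLp Y' Z' Pr := by
  intro p hp hp'
  obtain ⟨h1, h2, h3⟩ := h p hp hp'
  refine ⟨fun N => (memLp_congr_ae (hY N)).1 (h1 N), (memLp_congr_ae hZ).1 h2, ?_⟩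
  refine h3.congr fun N => eLpNorm_congr_ae ?_
  filter_upwards [hY N, hZ] with ω h1 h2
  rw [h1, h2]

variable [NormedSpace ℝ E] [NormedSpace ℝ F] [NormedSpace ℝ G]

theorem clm {Y : ℕ → Ω → E} {Z : Ω → E} (h : TendstoInAllLp Y Z Pr) (L : E →L[ℝ] F) :
    TendstoInAllLp (fun N ω => L (Y N ω)) (fun ω => L (Z ω)) Pr := by
  refine h.comp_of_norm_sub_le (C := ‖L‖)
    (fun N => L.continuous.comp_aestronglyMeasurable (h.memLp N le_rfl ENNReal.one_ne_top).1)
    (fun p hp hp' => L.comp_memLp' (h.memLp_limit hp hp')) fun N ω => ?_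
  rw [← map_sub]
  exact L.le_opNorm _

theorem const_smul {Y : ℕ → Ω → E} {Z : Ω → E} (h : TendstoInAllLp Y Z Pr) (c : ℝ) :
    TendstoInAllLp (fun N ω => c • Y N ω) (fun ω => c • Z ω) Pr := by
  simpa using h.clm (c • ContinuousLinearMap.id ℝ E)

theorem sub {Y Y' : ℕ → Ω → E} {Z Z' : Ω → E} (h : TendstoInAllLp Y Z Pr)
    (h' : TendstoInAllLp Y' Z' Pr) :
    TendstoInAllLp (fun N ω => Y N ω - Y' N ω) (fun ω => Z ω - Z' ω) Pr := by
  simpa [sub_eq_add_neg] using h.add (h'.const_smul (-1))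

/-- Convergence in all `L^p` is compatible with bilinear maps. -/
theorem bilin {Y : ℕ → Ω → E} {Z : Ω → E} {Y' : ℕ → Ω → F} {Z' : Ω → F}
    (h : TendstoInAllLp Y Z Pr) (h' : TendstoInAllLp Y' Z' Pr) (B : E →L[ℝ] F →L[ℝ] G) :
    TendstoInAllLp (fun N ω => B (Y N ω) (Y' N ω)) (fun ω => B (Z ω) (Z' ω)) Pr := by
  -- Hölder with 1/p = 1/(2p) + 1/(2p).
  have key : ∀ p : ℝ≥0∞, 1 ≤ p → p ≠ ∞ → ∀ {f : Ω → E} {g : Ω → F},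
      AEStronglyMeasurable f Pr → AEStronglyMeasurable g Pr →
      eLpNorm (fun ω => B (f ω) (g ω)) p Pr ≤
        ‖B‖₊ * eLpNorm f (2 * p) Pr * eLpNorm g (2 * p) Pr := by
    intro p hp hp' f g hf hg
    have : ENNReal.HolderTriple (2 * p) (2 * p) p := by
      constructor
      rw [ENNReal.mul_inv (by simp) (by simp), ← add_mul, ENNReal.inv_two_add_inv_two, one_mul]
    exact eLpNorm_le_eLpNorm_mul_eLpNorm_of_nnnorm hf hg (fun x y => B x y) ‖B‖₊
      (ae_of_all _ fun ω => B.le_opNorm₂ _ _)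
  have meas : ∀ {f : Ω → E} {g : Ω → F}, AEStronglyMeasurable f Pr → AEStronglyMeasurable g Pr →
      AEStronglyMeasurable (fun ω => B (f ω) (g ω)) Pr := fun hf hg => B.aestronglyMeasurable_comp₂ hf hg
  have mY := fun N => (h.memLp N le_rfl ENNReal.one_ne_top).1
  have mY' := fun N => (h'.memLp N le_rfl ENNReal.one_ne_top).1
  have mZ := (h.memLp_limit le_rfl ENNReal.one_ne_top).1
  have mZ' := (h'.memLp_limit le_rfl ENNReal.one_ne_top).1
  have hq : ∀ p : ℝ≥0∞, 1 ≤ p → p ≠ ∞ → 1 ≤ 2 * p ∧ 2 * p ≠ ∞ := fun p hp hp' =>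
    ⟨hp.trans (le_mul_of_one_le_left zero_le one_le_two), ENNReal.mul_ne_top (by simp) hp'⟩
  refine of_eLpNorm_le (fun N => meas (mY N) (mY' N)) (fun p hp hp' => ⟨meas mZ mZ', ?_⟩)
    fun p hp hp' => ?_
  · obtain ⟨h1, h2⟩ := hq p hp hp'
    exact (key p hp hp' mZ mZ').trans_lt (ENNReal.mul_lt_top
      (ENNReal.mul_lt_top ENNReal.coe_lt_top (h.memLp_limit h1 h2).2) (h'.memLp_limit h1 h2).2)
  · obtain ⟨h1, h2⟩ := hq p hp hp'
    set a : ℕ → ℝ≥0∞ := fun N => eLpNorm (fun ω => Y N ω - Z ω) (2 * p) Pr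
    set b : ℕ → ℝ≥0∞ := fun N => eLpNorm (fun ω => Y' N ω - Z' ω) (2 * p) Pr
    set A := eLpNorm Z (2 * p) Pr
    set A' := eLpNorm Z' (2 * p) Pr
    have hA : A ≠ ∞ := (h.memLp_limit h1 h2).2.ne
    have hA' : A' ≠ ∞ := (h'.memLp_limit h1 h2).2.ne
    have ha : ∀ N, a N ≠ ∞ := h.eLpNorm_ne_top h1 h2
    have hb : ∀ N, b N ≠ ∞ := h'.eLpNorm_ne_top h1 h2
    have ha0 : Tendsto a atTop (𝓝 0) := (h _ h1 h2).2.2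
    have hb0 : Tendsto b atTop (𝓝 0) := (h' _ h1 h2).2.2
    refine ⟨fun N => ‖B‖₊ * a N * b N + ‖B‖₊ * a N * A' + ‖B‖₊ * A * b N, fun N => ?_, ?_,
      fun N => ?_⟩
    · finiteness [ha N, hb N]
    · have hBa : Tendsto (fun N => (‖B‖₊ : ℝ≥0∞) * a N) atTop (𝓝 0) := by
        simpa using ENNReal.Tendsto.const_mul ha0 (Or.inr ENNReal.coe_ne_top)
      have t1 : Tendsto (fun N => ‖B‖₊ * a N * b N) atTop (𝓝 0) := by
        simpa using ENNReal.Tendsto.mul hBa (Or.inr ENNReal.zero_ne_top) hb0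
          (Or.inr ENNReal.zero_ne_top)
      have t2 : Tendsto (fun N => ‖B‖₊ * a N * A') atTop (𝓝 0) := by
        simpa using ENNReal.Tendsto.mul_const hBa (Or.inr hA')
      have t3 : Tendsto (fun N => ‖B‖₊ * A * b N) atTop (𝓝 0) := by
        simpa using ENNReal.Tendsto.const_mul hb0
          (Or.inr (ENNReal.mul_ne_top ENNReal.coe_ne_top hA))
      simpa using (t1.add t2).add t3
    -- Expanding around the limits leaves only differences and limits, so no uniform bound on the
    -- norms of the sequences is required.
    · have e : (fun ω => B (Y N ω) (Y' N ω) - B (Z ω) (Z' ω)) =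
          (fun ω => B (Y N ω - Z ω) (Y' N ω - Z' ω)) + (fun ω => B (Y N ω - Z ω) (Z' ω)) +
            fun ω => B (Z ω) (Y' N ω - Z' ω) := by
        ext ω
        simp only [Pi.add_apply, map_sub, sub_apply]
        abel
      rw [e]
      refine (eLpNorm_add_le ((meas ((mY N).sub mZ) ((mY' N).sub mZ')).add
        (meas ((mY N).sub mZ) mZ')) (meas mZ ((mY' N).sub mZ')) hp).trans ?_
      refine add_le_add ((eLpNorm_add_le (meas ((mY N).sub mZ) ((mY' N).sub mZ'))
        (meas ((mY N).sub mZ) mZ') hp).trans (add_le_add ?_ ?_)) ?_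
      · exact key p hp hp' ((mY N).sub mZ) ((mY' N).sub mZ')
      · exact key p hp hp' ((mY N).sub mZ) mZ'
      · exact key p hp hp' mZ ((mY' N).sub mZ')

theorem mul {Y Y' : ℕ → Ω → ℝ} {Z Z' : Ω → ℝ} (h : TendstoInAllLp Y Z Pr)
    (h' : TendstoInAllLp Y' Z' Pr) :
    TendstoInAllLp (fun N ω => Y N ω * Y' N ω) (fun ω => Z ω * Z' ω) Pr :=
  h.bilin h' (ContinuousLinearMap.mul ℝ ℝ)

/-- Convergence of random matrices follows from convergence of the entries. -/
theorem matrix_of_entries {ι κ : Type*} [Fintype ι] [Fintype κ] [DecidableEq ι] [DecidableEq κ]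
    {Y : ℕ → Ω → Matrix ι κ ℝ}
    {Z : Ω → Matrix ι κ ℝ}
    (h : ∀ a b, TendstoInAllLp (fun N ω => Y N ω a b) (fun ω => Z ω a b) Pr) :
    TendstoInAllLp Y Z Pr := by
  have := finset_sum (s := Finset.univ) fun a _ => finset_sum (s := Finset.univ) fun b _ =>
    (h a b).clm (ContinuousLinearMap.toSpanSingleton ℝ (Matrix.single a b (1 : ℝ)))
  have e : ∀ A : Matrix ι κ ℝ, ∑ a, ∑ b,
      ContinuousLinearMap.toSpanSingleton ℝ (Matrix.single a b (1 : ℝ)) (A a b) = A := by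
    intro A
    conv_rhs => rw [Matrix.matrix_eq_sum_single A]
    simp [ContinuousLinearMap.toSpanSingleton_apply, Matrix.smul_single]
  simpa only [e] using this

end TendstoInAllLp

/-! ### Averages over exchangeable arrays. -/

section Averages

variable {Ω : Type*} [MeasurableSpace Ω] {Pr : Measure Ω}

/-- Minkowski's inequality. Nothing is assumed about dependence between the summands, as the members
of the smoother are dependent. -/
theorem eLpNorm_average_le {E : Type*} [NormedAddCommGroup E] [NormedSpace ℝ E] {N : ℕ}
    {Y : Fin N → Ω → E} {p : ℝ≥0∞} (hp : 1 ≤ p) (hm : ∀ n, AEStronglyMeasurable (Y n) Pr)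
    {c : ℝ≥0∞} (hc : ∀ n, eLpNorm (Y n) p Pr ≤ c) :
    eLpNorm (fun ω => (N : ℝ)⁻¹ • ∑ n, Y n ω) p Pr ≤ c := by
  have e : (fun ω => (N : ℝ)⁻¹ • ∑ n, Y n ω) = (N : ℝ)⁻¹ • ∑ n, Y n := by
    ext ω
    simp
  rw [e]
  refine (eLpNorm_const_smul_le).trans ?_
  have hs : eLpNorm (∑ n, Y n) p Pr ≤ N * c := by
    refine (eLpNorm_sum_le (fun n _ => hm n) hp).trans ?_
    refine (Finset.sum_le_sum fun n _ => hc n).trans ?_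
    simp
  refine (mul_le_mul_right hs _).trans ?_
  rw [← mul_assoc]
  rcases Nat.eq_zero_or_pos N with h | h
  · subst h
    simp
  · have : ‖(N : ℝ)⁻¹‖ₑ * (N : ℝ≥0∞) = 1 := by
      rw [enorm_inv (by positivity)]
      simp only [Real.enorm_natCast]
      exact ENNReal.inv_mul_cancel (by positivity) (by simp)
    rw [this, one_mul]

/-- Law of large numbers in `L^p` for the rows of a triangular array which approximates an
independent identically distributed sequence. -/
theorem TendstoInAllLp.average [IsProbabilityMeasure Pr] {E : Type*} [NormedAddCommGroup E]
    [NormedSpace ℝ E] [CompleteSpace E] [MeasurableSpace E] [BorelSpace E]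
    [SecondCountableTopology E]
    {A : ∀ N : ℕ, Fin (N + 2) → Ω → E} {u : ℕ → Ω → E}
    (hA : ∀ N n, IdentDistrib (fun ω => (A N n ω, u n ω)) (fun ω => (A N 0 ω, u 0 ω)) Pr Pr)
    (hu : Pairwise fun n n' => u n ⟂ᵢ[Pr] u n') (hid : ∀ n, IdentDistrib (u n) (u 0) Pr Pr)
    (h : TendstoInAllLp (fun N => A N 0) (u 0) Pr) :
    TendstoInAllLp (fun N ω => ((N + 2 : ℕ) : ℝ)⁻¹ • ∑ n, A N n ω) (fun _ => ∫ ω, u 0 ω ∂Pr) Pr := by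
  have hA1 : ∀ N n, IdentDistrib (A N n) (A N 0) Pr Pr := fun N n => (hA N n).comp measurable_fst
  have hA2 : ∀ N n, IdentDistrib (fun ω => A N n ω - u n ω) (fun ω => A N 0 ω - u 0 ω) Pr Pr :=
    fun N n => (hA N n).comp (measurable_fst.sub measurable_snd)
  have lln : TendstoInAllLp (fun N ω => ((N + 2 : ℕ) : ℝ)⁻¹ • ∑ n : Fin (N + 2), u n ω)
      (fun _ => ∫ ω, u 0 ω ∂Pr) Pr := by
    intro p hp hp'
    have hm : ∀ n, MemLp (u n) p Pr := fun n => (hid n).memLp_iff.2 (h.memLp_limit hp hp')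
    refine ⟨fun N => ?_, memLp_const _, ?_⟩
    · exact (memLp_finsetSum Finset.univ fun (n : Fin (N + 2)) _ => hm n).const_smul _
    -- Row `N` has `N + 2` members, hence the shift.
    · have := (strong_law_Lp hp hp' u (hm 0) hu hid).comp (tendsto_add_atTop_nat 2)
      refine this.congr fun N => ?_
      simp only [Function.comp, Finset.sum_range]
  -- All differences in a row have the law of the first one, so its L^p norm bounds the norm of
  -- their average.
  have diff : TendstoInAllLp (fun N ω => ((N + 2 : ℕ) : ℝ)⁻¹ • ∑ n, (A N n ω - u n ω))
      (fun _ => 0) Pr := by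
    have hm : ∀ N n, AEStronglyMeasurable (fun ω => A N n ω - u n ω) Pr := fun N n =>
      (hA2 N n).aemeasurable_fst.aestronglyMeasurable
    refine TendstoInAllLp.of_eLpNorm_le (fun N => ?_) (fun p _ _ => MemLp.zero) fun p hp hp' =>
      ⟨fun N => eLpNorm (fun ω => A N 0 ω - u 0 ω) p Pr, h.eLpNorm_ne_top hp hp',
        (h p hp hp').2.2, fun N => ?_⟩
    · exact (Finset.aestronglyMeasurable_fun_sum _ fun n _ => hm N n).const_smul _
    · simp only [sub_zero]
      exact eLpNorm_average_le hp (hm N) fun n => ((hA2 N n).eLpNorm_eq p).le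
  simpa [← smul_add, ← Finset.sum_add_distrib] using diff.add lln

end Averages

/-! ### Convergence of sample mean and sample covariance. -/

section SampleMoments

variable {Ω : Type*} [MeasurableSpace Ω] {Pr : Measure Ω} {ι : Type*}

theorem sampleMean_apply {N : ℕ} (E : Fin N → EuclideanSpace ℝ ι) (a : ι) :
    sampleMean E a = (N : ℝ)⁻¹ • ∑ n, E n a := by
  simp [sampleMean]

/-- Reduces the covariance to averages of coordinates and of their products, to which the law of
large numbers applies. -/
theorem sampleCov_apply {N : ℕ} (hN : N ≠ 0) (E : Fin N → EuclideanSpace ℝ ι) (a b : ι) :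
    sampleCov E a b = N / ((N : ℝ) - 1) *
      ((N : ℝ)⁻¹ • ∑ n, E n a * E n b -
        ((N : ℝ)⁻¹ • ∑ n, E n a) * ((N : ℝ)⁻¹ • ∑ n, E n b)) := by
  have h : (N : ℝ) ≠ 0 := by exact_mod_cast hN
  have e : ∑ n, (E n a - sampleMean E a) * (E n b - sampleMean E b) =
      N * ((N : ℝ)⁻¹ • ∑ n, E n a * E n b -
        ((N : ℝ)⁻¹ • ∑ n, E n a) * ((N : ℝ)⁻¹ • ∑ n, E n b)) := by
    simp only [sampleMean_apply, smul_eq_mul, sub_mul, mul_sub, Finset.sum_sub_distrib,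
      ← Finset.sum_mul, ← Finset.mul_sum, Finset.sum_const, Finset.card_univ, Fintype.card_fin,
      nsmul_eq_mul]
    field_simp
    ring
  have e' : sampleCov E a b =
      ((N : ℝ) - 1)⁻¹ * ∑ n, (E n a - sampleMean E a) * (E n b - sampleMean E b) := by
    simp [sampleCov, Matrix.sum_apply, Matrix.vecMulVec_apply]
  rw [e', e, div_eq_inv_mul, mul_assoc]

variable [Fintype ι]

theorem TendstoInAllLp.sampleMean [IsProbabilityMeasure Pr]
    {A : ∀ N : ℕ, Fin (N + 2) → Ω → EuclideanSpace ℝ ι} {u : ℕ → Ω → EuclideanSpace ℝ ι}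
    (hA : ∀ N n, IdentDistrib (fun ω => (A N n ω, u n ω)) (fun ω => (A N 0 ω, u 0 ω)) Pr Pr)
    (hu : Pairwise fun n n' => u n ⟂ᵢ[Pr] u n') (hid : ∀ n, IdentDistrib (u n) (u 0) Pr Pr)
    (h : TendstoInAllLp (fun N => A N 0) (u 0) Pr) :
    TendstoInAllLp (fun N ω => sampleMean fun n => A N n ω) (fun _ => ∫ ω, u 0 ω ∂Pr) Pr :=
  TendstoInAllLp.average hA hu hid h

theorem TendstoInAllLp.sampleCov [IsProbabilityMeasure Pr] [DecidableEq ι]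
    {A : ∀ N : ℕ, Fin (N + 2) → Ω → EuclideanSpace ℝ ι} {u : ℕ → Ω → EuclideanSpace ℝ ι}
    (hA : ∀ N n, IdentDistrib (fun ω => (A N n ω, u n ω)) (fun ω => (A N 0 ω, u 0 ω)) Pr Pr)
    (hu : Pairwise fun n n' => u n ⟂ᵢ[Pr] u n') (hid : ∀ n, IdentDistrib (u n) (u 0) Pr Pr)
    (h : TendstoInAllLp (fun N => A N 0) (u 0) Pr) :
    TendstoInAllLp (fun N ω => sampleCov fun n => A N n ω)
      (fun _ => covarianceMatrix Pr (u 0)) Pr := by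
  have coord : ∀ a : ι, Measurable fun x : EuclideanSpace ℝ ι => x a := fun a =>
    (EuclideanSpace.proj (𝕜 := ℝ) a).continuous.measurable
  have hconv : ∀ a, TendstoInAllLp (fun N ω => A N 0 ω a) (fun ω => u 0 ω a) Pr := fun a =>
    h.clm (EuclideanSpace.proj (𝕜 := ℝ) a)
  have avg : ∀ f : EuclideanSpace ℝ ι → ℝ, Measurable f →
      TendstoInAllLp (fun N ω => f (A N 0 ω)) (fun ω => f (u 0 ω)) Pr →
      TendstoInAllLp (fun N ω => ((N + 2 : ℕ) : ℝ)⁻¹ • ∑ n, f (A N n ω))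
        (fun _ => ∫ ω, f (u 0 ω) ∂Pr) Pr := by
    intro f hf hc
    exact TendstoInAllLp.average (A := fun N n ω => f (A N n ω)) (u := fun n ω => f (u n ω))
      (fun N n => (hA N n).comp 
        (u := fun x : EuclideanSpace ℝ ι × EuclideanSpace ℝ ι => (f x.1, f x.2))
        ((hf.comp measurable_fst).prodMk (hf.comp measurable_snd)))
      (fun n n' hn => (hu hn).comp hf hf) (fun n => (hid n).comp hf) hc
  refine TendstoInAllLp.matrix_of_entries fun a b => ?_
  have h1 := avg (fun x => x a) (coord a) (hconv a)
  have h2 := avg (fun x => x b) (coord b) (hconv b)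
  have h3 := avg (fun x => x a * x b) ((coord a).mul (coord b)) ((hconv a).mul (hconv b))
  -- The effect of normalizing by the number of members minus one disappears in the limit.
  have hc : Tendsto (fun N : ℕ => ((N + 2 : ℕ) : ℝ) / (((N + 2 : ℕ) : ℝ) - 1)) atTop (𝓝 1) := by
    have h0 := tendsto_one_div_add_atTop_nhds_zero_nat (𝕜 := ℝ)
    have := h0.const_add 1
    rw [add_zero] at this
    refine this.congr fun N => ?_
    have hN : (N : ℝ) + 1 ≠ 0 := by positivity
    have e : ((N + 2 : ℕ) : ℝ) - 1 = N + 1 := by push_cast; ring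
    rw [e]
    field_simp
    push_cast
    ring
  have h4 := (TendstoInAllLp.of_tendsto (Pr := Pr) hc).mul (h3.sub (h1.mul h2))
  have hcov : covarianceMatrix Pr (u 0) a b = 1 * (∫ ω, u 0 ω a * u 0 ω b ∂Pr -
      (∫ ω, u 0 ω a ∂Pr) * ∫ ω, u 0 ω b ∂Pr) := by
    rw [one_mul]
    exact covariance_eq_sub ((hconv a).memLp_limit one_le_two ENNReal.ofNat_ne_top)
      ((hconv b).memLp_limit one_le_two ENNReal.ofNat_ne_top)
  simp only [hcov]
  have e : ∀ N ω, (_root_.sampleCov fun n => A N n ω) a b = _ := fun N ω =>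
    sampleCov_apply (Nat.succ_ne_zero (N + 1)) (fun n => A N n ω) a b
  simp only [e]
  exact h4

end SampleMoments
-- Uniform bounds for inverses of shifted positive semidefinite matrices.
section MatrixAction

variable {ι κ : Type*} [Fintype ι] [Fintype κ] [DecidableEq ι]

/-- The action of matrices on vectors as a continuous bilinear map. -/
noncomputable def matrixAction (κ ι : Type*) [Fintype ι] [Fintype κ] [DecidableEq ι] :
    Matrix κ ι ℝ →L[ℝ] EuclideanSpace ℝ ι →L[ℝ] EuclideanSpace ℝ κ :=
  LinearMap.toContinuousLinearMap
    ((Matrix.toEuclideanLin (𝕜 := ℝ) (m := κ) (n := ι)).trans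
      LinearMap.toContinuousLinearMap).toLinearMap

theorem matrixAction_apply (A : Matrix κ ι ℝ) (x : EuclideanSpace ℝ ι) :
    matrixAction κ ι A x = A.toEuclideanLin x := rfl

theorem continuous_toEuclideanLin (κ ι : Type*) [Fintype ι] [Fintype κ] [DecidableEq ι] :
    Continuous fun p : Matrix κ ι ℝ × EuclideanSpace ℝ ι => p.1.toEuclideanLin p.2 := by
  have h : Continuous fun p : Matrix κ ι ℝ × EuclideanSpace ℝ ι => matrixAction κ ι p.1 p.2 :=
    ((matrixAction κ ι).continuous.comp continuous_fst).clm_apply continuous_snd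
  exact h

theorem Matrix.l2_opNorm_le_bound (A : Matrix κ ι ℝ) {C : ℝ} (hC : 0 ≤ C)
    (h : ∀ x : EuclideanSpace ℝ ι, ‖A.toEuclideanLin x‖ ≤ C * ‖x‖) : ‖A‖ ≤ C := by
  rw [Matrix.l2_opNorm_def]
  exact ContinuousLinearMap.opNorm_le_bound _ hC h

omit [Fintype κ] in
theorem Matrix.toEuclideanLin_mul_apply {ι' : Type*} [Fintype ι']
    [DecidableEq ι'] (A : Matrix κ ι ℝ) (B : Matrix ι ι' ℝ) (x : EuclideanSpace ℝ ι') :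
    (A * B).toEuclideanLin x = A.toEuclideanLin (B.toEuclideanLin x) := by
  simp [Matrix.toLpLin_apply, Matrix.mulVec_mulVec]

theorem Matrix.inner_toEuclideanLin (A : Matrix ι ι ℝ) (x : EuclideanSpace ℝ ι) :
    inner ℝ x (A.toEuclideanLin x) = x.ofLp ⬝ᵥ (A *ᵥ x.ofLp) := by
  rw [Matrix.toLpLin_apply, EuclideanSpace.inner_eq_star_dotProduct]
  simp [dotProduct_comm]

theorem Matrix.PosDef.exists_coercive {R : Matrix ι ι ℝ} (hR : R.PosDef) :
    ∃ r : ℝ, 0 < r ∧ ∀ x : EuclideanSpace ℝ ι, r * ‖x‖ ^ 2 ≤ inner ℝ x (R.toEuclideanLin x) := by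
  have hcont : Continuous fun x : EuclideanSpace ℝ ι => inner ℝ x (R.toEuclideanLin x) :=
    continuous_id.inner (R.toEuclideanLin.continuous_of_finiteDimensional)
  have hpos : ∀ x : EuclideanSpace ℝ ι, x ≠ 0 → 0 < inner ℝ x (R.toEuclideanLin x) := by
    intro x hx
    rw [Matrix.inner_toEuclideanLin]
    have := hR.dotProduct_mulVec_pos (x := x.ofLp) (by simpa using hx)
    simpa using this
  -- The sphere is empty in dimension zero. Otherwise `r` is the minimum of the quadratic form on
  -- it, which is attained and positive.
  rcases (Metric.sphere (0 : EuclideanSpace ℝ ι) 1).eq_empty_or_nonempty with he | hne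
  · refine ⟨1, one_pos, fun x => ?_⟩
    have hx : x = 0 := by
      by_contra hx
      have : (‖x‖⁻¹ • x) ∈ Metric.sphere (0 : EuclideanSpace ℝ ι) 1 := by
        simp [norm_smul, hx]
      simp [he] at this
    simp [hx]
  · obtain ⟨y, hy, hmin⟩ := (isCompact_sphere (0 : EuclideanSpace ℝ ι) 1).exists_isMinOn hne
      hcont.continuousOn
    have hy0 : y ≠ 0 := by
      rintro rfl
      simp at hy
    refine ⟨_, hpos y hy0, fun x => ?_⟩
    by_cases hx : x = 0
    · simp [hx]
    have hxs : (‖x‖⁻¹ • x) ∈ Metric.sphere (0 : EuclideanSpace ℝ ι) 1 := by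
      simp [norm_smul, hx]
    have h1 := hmin hxs
    simp only [Set.mem_ofPred_eq, map_smul, inner_smul_left, inner_smul_right] at h1
    have hn : 0 < ‖x‖ := norm_pos_iff.2 hx
    simp only [conj_trivial] at h1
    calc _ ≤ (‖x‖⁻¹ * (‖x‖⁻¹ * inner ℝ x (R.toEuclideanLin x))) * ‖x‖ ^ 2 := by gcongr
      _ = _ := by field_simp

/-- If (A + R)y = z, then r‖y‖² ≤ ⟨y, Ry⟩ ≤ ⟨y, z⟩ ≤ ‖y‖‖z‖, where r is the coercivity constant of
R. The size of A plays no role. -/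
theorem Matrix.PosDef.exists_norm_inv_add_le {R : Matrix ι ι ℝ} (hR : R.PosDef) :
    ∃ C : ℝ, 0 ≤ C ∧ ∀ A : Matrix ι ι ℝ, A.PosSemidef → ‖(A + R)⁻¹‖ ≤ C := by
  obtain ⟨r, hr, h⟩ := hR.exists_coercive
  refine ⟨r⁻¹, by positivity, fun A hA => ?_⟩
  refine Matrix.l2_opNorm_le_bound _ (by positivity) fun z => ?_
  set y := (A + R)⁻¹.toEuclideanLin z with hy
  have hz : (A + R).toEuclideanLin y = z := by
    have hu : IsUnit (A + R).det :=
      (Matrix.isUnit_iff_isUnit_det _).1 (Matrix.PosDef.posSemidef_add hA hR).isUnit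
    rw [hy, ← Matrix.toEuclideanLin_mul_apply, Matrix.mul_nonsing_inv _ hu]
    simp
  have h1 : r * ‖y‖ ^ 2 ≤ ‖y‖ * ‖z‖ := by
    calc r * ‖y‖ ^ 2 ≤ inner ℝ y (R.toEuclideanLin y) := h y
      _ ≤ inner ℝ y (A.toEuclideanLin y) + inner ℝ y (R.toEuclideanLin y) := by
        have := hA.dotProduct_mulVec_nonneg y.ofLp
        rw [Matrix.inner_toEuclideanLin A]
        simp only [star_trivial] at this
        linarith
      _ = inner ℝ y z := by
        rw [← inner_add_right, ← LinearMap.add_apply, ← map_add, hz]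
      _ ≤ _ := real_inner_le_norm y z
  rcases (norm_nonneg y).eq_or_lt with h0 | h0
  · rw [← h0]
    positivity
  · rw [inv_mul_eq_div, le_div_iff₀ hr]
    nlinarith

omit [DecidableEq ι] in
theorem sampleCov_posSemidef {N : ℕ} (E : Fin (N + 1) → EuclideanSpace ℝ ι) :
    (sampleCov E).PosSemidef := by
  refine Matrix.PosSemidef.smul (Matrix.posSemidef_sum _ fun n _ => ?_) ?_
  · simpa using Matrix.posSemidef_vecMulVec_self_star (E n - sampleMean E).ofLp
  -- The normalization is `N⁻¹`, hence nonnegative; for one member it is zero.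
  · simp

end MatrixAction

/-! ### Measurability of matrix operations. -/

section StronglyMeasurable

variable {Ω : Type*} [MeasurableSpace Ω] {ι κ l : Type*} [Fintype ι]

theorem MeasureTheory.StronglyMeasurable.matrix_mul {A : Ω → Matrix κ ι ℝ} {B : Ω → Matrix ι l ℝ}
    (hA : StronglyMeasurable A) (hB : StronglyMeasurable B) :
    StronglyMeasurable fun ω => A ω * B ω :=
  (continuous_fst.matrix_mul continuous_snd : Continuous
    fun p : Matrix κ ι ℝ × Matrix ι l ℝ => p.1 * p.2).comp_stronglyMeasurable (hA.prodMk hB)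

/-- Inversion is not continuous at singular matrices, so Cramer's formula is used: the adjugate is
continuous and real inversion is measurable. -/
theorem MeasureTheory.StronglyMeasurable.matrix_inv [DecidableEq ι] {A : Ω → Matrix ι ι ℝ}
    (hA : StronglyMeasurable A) : StronglyMeasurable fun ω => (A ω)⁻¹ := by
  simp only [Matrix.inv_def, Ring.inverse_eq_inv']
  have hdet : StronglyMeasurable fun ω => (A ω).det :=
    (continuous_id.matrix_det : Continuous fun M : Matrix ι ι ℝ => M.det).comp_stronglyMeasurable hA
  have hadj : StronglyMeasurable fun ω => (A ω).adjugate :=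
    (continuous_id.matrix_adjugate :
      Continuous fun M : Matrix ι ι ℝ => M.adjugate).comp_stronglyMeasurable hA
  exact (hdet.measurable.inv.stronglyMeasurable).smul hadj

theorem MeasureTheory.StronglyMeasurable.toEuclideanLin_apply [Fintype κ] [DecidableEq ι] {A : Ω → Matrix κ ι ℝ}
    {x : Ω → EuclideanSpace ℝ ι} (hA : StronglyMeasurable A) (hx : StronglyMeasurable x) :
    StronglyMeasurable fun ω => (A ω).toEuclideanLin (x ω) := by
  have h := hA.prodMk hx
  exact (continuous_toEuclideanLin κ ι).comp_stronglyMeasurable (f := fun ω => (A ω, x ω)) h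

theorem MeasureTheory.StronglyMeasurable.sampleCov {N : ℕ}
    {E : Ω → Fin N → EuclideanSpace ℝ ι}
    (hE : ∀ n, StronglyMeasurable fun ω => E ω n) :
    StronglyMeasurable fun ω => sampleCov (E ω) := by
  have hm : StronglyMeasurable fun ω => sampleMean (E ω) := by
    have hs : StronglyMeasurable fun ω => ∑ n, E ω n :=
      Finset.stronglyMeasurable_fun_sum _ fun n _ => hE n
    exact hs.const_smul (N : ℝ)⁻¹
  have hc : Continuous fun v : EuclideanSpace ℝ ι => Matrix.vecMulVec v.ofLp v.ofLp := by
    refine continuous_matrix fun a b => ?_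
    simp only [Matrix.vecMulVec_apply]
    fun_prop
  have hs : StronglyMeasurable fun ω => ∑ n, Matrix.vecMulVec (E ω n - sampleMean (E ω)).ofLp
      (E ω n - sampleMean (E ω)).ofLp :=
    Finset.stronglyMeasurable_fun_sum _ fun n _ => hc.comp_stronglyMeasurable ((hE n).sub hm)
  exact hs.const_smul ((N : ℝ) - 1)⁻¹

end StronglyMeasurable

/-! ### The gain as a function of the forecast covariance. -/

namespace LinearSystem

variable {m : ℕ} {o : ℕ → ℕ} (S : LinearSystem m o)

theorem posSemidef_obs (i : ℕ) {P : Matrix (Fin (i + 1) × Fin m) (Fin (i + 1) × Fin m) ℝ}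
    (hP : P.PosSemidef) : (S.obsMatrix i * P * (S.obsMatrix i)ᵀ).PosSemidef := by
  simpa using hP.mul_mul_conjTranspose_same (S.obsMatrix i)

theorem isUnit_innovationCov (i : ℕ) (hR : (S.R i).PosDef)
    {P : Matrix (Fin (i + 1) × Fin m) (Fin (i + 1) × Fin m) ℝ} (hP : P.PosSemidef) :
    IsUnit (S.obsMatrix i * P * (S.obsMatrix i)ᵀ + S.R i).det :=
  (Matrix.isUnit_iff_isUnit_det _).1
    (Matrix.PosDef.posSemidef_add (S.posSemidef_obs i hP) hR).isUnit

/-- Both inverses are bounded uniformly over positive semidefinite matrices, so `C` depends on `P'`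
but not on `P`. This matters because sample covariances are unbounded. -/
theorem exists_norm_gain_sub_le (i : ℕ) (hR : (S.R i).PosDef)
    {P' : Matrix (Fin (i + 1) × Fin m) (Fin (i + 1) × Fin m) ℝ} (hP' : P'.PosSemidef) :
    ∃ C : ℝ, ∀ P : Matrix (Fin (i + 1) × Fin m) (Fin (i + 1) × Fin m) ℝ, P.PosSemidef →
      ‖S.gain i P - S.gain i P'‖ ≤ C * ‖P - P'‖ := by
  obtain ⟨c, hc, hinv⟩ := hR.exists_norm_inv_add_le
  set H := S.obsMatrix i
  refine ⟨‖Hᵀ‖ * c + ‖P'‖ * ‖Hᵀ‖ * (c * (‖H‖ * ‖Hᵀ‖) * c), fun P hP => ?_⟩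
  set T := (H * P * Hᵀ + S.R i)⁻¹ with hT
  set T' := (H * P' * Hᵀ + S.R i)⁻¹ with hT'
  have hTc : ‖T‖ ≤ c := hinv _ (S.posSemidef_obs i hP)
  have hTc' : ‖T'‖ ≤ c := hinv _ (S.posSemidef_obs i hP')
  -- The resolvent identity.
  have e : T - T' = T * (H * (P' - P) * Hᵀ) * T' := by
    have h1 : H * (P' - P) * Hᵀ = (H * P' * Hᵀ + S.R i) - (H * P * Hᵀ + S.R i) := by
      simp only [Matrix.mul_sub, Matrix.sub_mul]
      abel
    rw [h1, Matrix.mul_sub, Matrix.sub_mul, Matrix.mul_assoc, hT', hT,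
      Matrix.mul_nonsing_inv _ (S.isUnit_innovationCov i hR hP'),
      Matrix.nonsing_inv_mul _ (S.isUnit_innovationCov i hR hP), Matrix.mul_one, Matrix.one_mul]
  have e2 : S.gain i P - S.gain i P' =
      (P - P') * Hᵀ * T + P' * Hᵀ * (T * (H * (P' - P) * Hᵀ) * T') := by
    rw [← e]
    simp only [gain, Matrix.sub_mul, Matrix.mul_sub]
    abel
  have hTT : ‖T * (H * (P' - P) * Hᵀ) * T'‖ ≤ c * (‖H‖ * ‖P - P'‖ * ‖Hᵀ‖) * c := by
    refine (Matrix.l2_opNorm_mul _ _).trans ?_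
    gcongr
    refine (Matrix.l2_opNorm_mul _ _).trans ?_
    gcongr
    refine (Matrix.l2_opNorm_mul _ _).trans ?_
    gcongr
    rw [norm_sub_rev P P']
    exact Matrix.l2_opNorm_mul _ _
  rw [e2]
  calc _ ≤ ‖P - P'‖ * ‖Hᵀ‖ * c + ‖P'‖ * ‖Hᵀ‖ * (c * (‖H‖ * ‖P - P'‖ * ‖Hᵀ‖) * c) := by
        refine (norm_add_le _ _).trans (add_le_add ?_ ?_)
        · refine (Matrix.l2_opNorm_mul _ _).trans ?_
          gcongr
          exact Matrix.l2_opNorm_mul _ _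
        · refine (Matrix.l2_opNorm_mul _ _).trans ?_
          gcongr
          exact Matrix.l2_opNorm_mul _ _
    _ = _ := by ring

variable {Ω : Type*} [MeasurableSpace Ω]

theorem stronglyMeasurable_gain (i : ℕ)
    {P : Ω → Matrix (Fin (i + 1) × Fin m) (Fin (i + 1) × Fin m) ℝ} (hP : StronglyMeasurable P) :
    StronglyMeasurable fun ω => S.gain i (P ω) :=
  (hP.matrix_mul stronglyMeasurable_const).matrix_mul
    ((((stronglyMeasurable_const.matrix_mul hP).matrix_mul stronglyMeasurable_const).add
      stronglyMeasurable_const).matrix_inv)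

theorem stronglyMeasurable_advance (i : ℕ) {x : Ω → Composite m i}
    {v : Ω → EuclideanSpace ℝ (Fin m)} (hx : StronglyMeasurable x) (hv : StronglyMeasurable v) :
    StronglyMeasurable fun ω => S.advance i (x ω) (v ω) :=
  (stronglyMeasurable_const.toEuclideanLin_apply hx).add
    (stronglyMeasurable_const.toEuclideanLin_apply (stronglyMeasurable_const.add hv))

theorem stronglyMeasurable_analysis (i : ℕ)
    {P : Ω → Matrix (Fin (i + 1) × Fin m) (Fin (i + 1) × Fin m) ℝ} {x : Ω → Composite m i}
    {w : Ω → EuclideanSpace ℝ (Fin (o i))} (hP : StronglyMeasurable P) (hx : StronglyMeasurable x)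
    (hw : StronglyMeasurable w) : StronglyMeasurable fun ω => S.analysis i (P ω) (x ω) (w ω) :=
  hx.add ((S.stronglyMeasurable_gain i hP).toEuclideanLin_apply
    ((stronglyMeasurable_const.sub hw).sub (stronglyMeasurable_const.toEuclideanLin_apply hx)))

end LinearSystem
-- Forecast ensembles and recursions with deterministic gains.
section Recursions

variable {Ω : Type*} {m : ℕ} {o : ℕ → ℕ} (S : LinearSystem m o) (ξ : RandomInputs Ω m o)

/-- The forecast ensemble `X_{0:i+1|i}` of the ensemble Kalman smoother. -/
noncomputable def enksForecast (N i : ℕ) (ω : Ω) (n : Fin N) : Composite m (i + 1) :=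
  S.advance i (enks S ξ N i ω n) (ξ.model (i + 1) n ω)

theorem enks_succ (N i : ℕ) (ω : Ω) (n : Fin N) :
    enks S ξ N (i + 1) ω n = S.analysis (i + 1) (sampleCov (enksForecast S ξ N i ω))
      (enksForecast S ξ N i ω n) (ξ.obs (i + 1) n ω) := rfl

/-- The ensemble with deterministic gains given by the forecast covariances `C i`. -/
noncomputable def fixedGainEnsemble (C : ∀ i, Matrix (Fin (i + 1) × Fin m) (Fin (i + 1) × Fin m) ℝ) :
    (i : ℕ) → ℕ → Ω → Composite m i
  | 0 => fun n ω => compositeZero (ξ.init n ω)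
  | i + 1 => fun n ω => S.analysis (i + 1) (C (i + 1))
      (S.advance i (fixedGainEnsemble C i n ω) (ξ.model (i + 1) n ω)) (ξ.obs (i + 1) n ω)

variable [MeasurableSpace Ω] (Pr : Measure Ω)

/-- The forecast ensemble `U_{0:i+1|i}` of the reference ensemble. -/
noncomputable def refForecast (i n : ℕ) (ω : Ω) : Composite m (i + 1) :=
  S.advance i (refEnsemble S ξ Pr i n ω) (ξ.model (i + 1) n ω)

/-- The exact covariance matrices used in the reference ensemble. -/
noncomputable def refForecastCov : ∀ i, Matrix (Fin (i + 1) × Fin m) (Fin (i + 1) × Fin m) ℝ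
  -- Never read, since the first gain is the one at time 1.
  | 0 => 0
  | i + 1 => covarianceMatrix Pr (refForecast S ξ Pr i 0)

theorem refEnsemble_succ (i n : ℕ) (ω : Ω) :
    refEnsemble S ξ Pr (i + 1) n ω = S.analysis (i + 1)
      (covarianceMatrix Pr (refForecast S ξ Pr i 0)) (refForecast S ξ Pr i n ω)
      (ξ.obs (i + 1) n ω) := rfl

/-- Freezes the covariances: those in `refEnsemble` are computed from the inputs themselves, and
renumbering or replacing the inputs would alter them formally. -/
theorem refEnsemble_eq_fixedGainEnsemble (i n : ℕ) (ω : Ω) :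
    refEnsemble S ξ Pr i n ω = fixedGainEnsemble S ξ (refForecastCov S ξ Pr) i n ω := by
  induction i with
  | zero => rfl
  | succ i ih =>
    rw [refEnsemble_succ, refForecast, ih]
    rfl

end Recursions

/-! ### Renumbering the members and factoring through the inputs. -/

section Reindexing

variable {Ω : Type*} {m : ℕ} {o : ℕ → ℕ}

/-- Renumbering of the members. -/
def RandomInputs.reindex (ξ : RandomInputs Ω m o) (f : ℕ → ℕ) : RandomInputs Ω m o where
  init n := ξ.init (f n)
  model i n := ξ.model i (f n)
  obs i n := ξ.obs i (f n)

theorem sampleMean_comp_perm {ι : Type*} {N : ℕ} (E : Fin N → EuclideanSpace ℝ ι)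
    (π : Equiv.Perm (Fin N)) : sampleMean (fun n => E (π n)) = sampleMean E := by
  rw [sampleMean, sampleMean, Equiv.sum_comp π E]

theorem sampleCov_comp_perm {ι : Type*} {N : ℕ} (E : Fin N → EuclideanSpace ℝ ι)
    (π : Equiv.Perm (Fin N)) : sampleCov (fun n => E (π n)) = sampleCov E := by
  rw [sampleCov, sampleCov, sampleMean_comp_perm,
    Equiv.sum_comp π fun n => Matrix.vecMulVec (E n - sampleMean E).ofLp (E n - sampleMean E).ofLp]

/-- The members interact only through the sample covariance, which is a symmetric function of the
ensemble. -/
theorem enks_reindex (S : LinearSystem m o) (ξ : RandomInputs Ω m o) {N : ℕ}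
    (π : Equiv.Perm (Fin N)) {f : ℕ → ℕ} (hf : ∀ n : Fin N, f n = π n) (i : ℕ) (ω : Ω)
    (n : Fin N) : enks S (ξ.reindex f) N i ω n = enks S ξ N i ω (π n) := by
  induction i generalizing n with
  | zero => simp [enks, RandomInputs.reindex, hf]
  | succ i ih =>
    have h : enksForecast S (ξ.reindex f) N i ω = fun n => enksForecast S ξ N i ω (π n) := by
      ext1 n
      rw [enksForecast, enksForecast, ih, ← hf]
      rfl
    rw [enks_succ, enks_succ, h, sampleCov_comp_perm]
    simp [RandomInputs.reindex, hf]

theorem fixedGainEnsemble_reindex (S : LinearSystem m o) (ξ : RandomInputs Ω m o)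
    (C : ∀ i, Matrix (Fin (i + 1) × Fin m) (Fin (i + 1) × Fin m) ℝ) (f : ℕ → ℕ) (i n : ℕ)
    (ω : Ω) : fixedGainEnsemble S (ξ.reindex f) C i n ω = fixedGainEnsemble S ξ C i (f n) ω := by
  induction i with
  | zero => rfl
  | succ i ih => simp only [fixedGainEnsemble, ih]; rfl

/-- The coordinates as random inputs on the space of all values of the inputs up to time `k`. -/
def coordinateInputs (m : ℕ) (o : ℕ → ℕ) (k : ℕ) :
    RandomInputs (∀ j : InputIndex k, EuclideanSpace ℝ (Fin (j.dim m o))) m o where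
  init n x := x (.init n)
  model
    -- Inputs at time 0 or after time `k` do not influence the ensembles up to time `k`.
    | 0, _, _ => 0
    | i + 1, n, x => if h : i < k then x (.model ⟨i, h⟩ n) else 0
  obs
    | 0, _, _ => 0
    | i + 1, n, x => if h : i < k then x (.obs ⟨i, h⟩ n) else 0

variable {k : ℕ} (S : LinearSystem m o) (ξ : RandomInputs Ω m o)

theorem coordinateInputs_model {i : ℕ} (hi : i < k) (n : ℕ) (ω : Ω) :
    (coordinateInputs m o k).model (i + 1) n (fun j => ξ.family k j ω) = ξ.model (i + 1) n ω :=
  dif_pos hi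

theorem coordinateInputs_obs {i : ℕ} (hi : i < k) (n : ℕ) (ω : Ω) :
    (coordinateInputs m o k).obs (i + 1) n (fun j => ξ.family k j ω) = ξ.obs (i + 1) n ω :=
  dif_pos hi

/-- Exhibits the ensemble as a fixed function of the input family, so that equality in law of input
families passes to ensembles. -/
theorem enks_eq_coordinateInputs {i : ℕ} (hi : i ≤ k) (N : ℕ) (ω : Ω) (n : Fin N) :
    enks S ξ N i ω n = enks S (coordinateInputs m o k) N i (fun j => ξ.family k j ω) n := by
  induction i generalizing n with
  | zero => rfl
  | succ i ih =>
    have h : enksForecast S ξ N i ω =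
        enksForecast S (coordinateInputs m o k) N i (fun j => ξ.family k j ω) := by
      ext1 n
      rw [enksForecast, enksForecast, ih (by omega), coordinateInputs_model ξ hi]
    rw [enks_succ, enks_succ, h, coordinateInputs_obs ξ hi]

theorem fixedGainEnsemble_eq_coordinateInputs
    (C : ∀ i, Matrix (Fin (i + 1) × Fin m) (Fin (i + 1) × Fin m) ℝ) {i : ℕ} (hi : i ≤ k) (n : ℕ)
    (ω : Ω) : fixedGainEnsemble S ξ C i n ω =
      fixedGainEnsemble S (coordinateInputs m o k) C i n (fun j => ξ.family k j ω) := by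
  induction i with
  | zero => rfl
  | succ i ih =>
    simp only [fixedGainEnsemble]
    rw [ih (by omega), coordinateInputs_model ξ hi,
      coordinateInputs_obs ξ hi]

end Reindexing

/-! ### Measurability of the ensembles. -/

section Measurability

variable {Ω : Type*} {m : ℕ} {o : ℕ → ℕ} (S : LinearSystem m o) (ξ : RandomInputs Ω m o)

theorem continuous_compositeZero : Continuous (compositeZero (m := m)) := by
  unfold compositeZero
  fun_prop

theorem stronglyMeasurable_enks [MeasurableSpace Ω] (N i : ℕ)
    (h0 : ∀ n, StronglyMeasurable (ξ.init n))
    (hV : ∀ j < i, ∀ n, StronglyMeasurable (ξ.model (j + 1) n))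
    (hW : ∀ j < i, ∀ n, StronglyMeasurable (ξ.obs (j + 1) n)) (n : Fin N) :
    StronglyMeasurable fun ω => enks S ξ N i ω n := by
  induction i generalizing n with
  | zero => exact continuous_compositeZero.comp_stronglyMeasurable (h0 n)
  | succ i ih =>
    have hf : ∀ n, StronglyMeasurable fun ω => enksForecast S ξ N i ω n := fun n =>
      S.stronglyMeasurable_advance i
        (ih (fun j hj => hV j (by omega)) (fun j hj => hW j (by omega)) n) (hV i i.lt_succ_self n)
    exact S.stronglyMeasurable_analysis (i + 1)
      (MeasureTheory.StronglyMeasurable.sampleCov hf) (hf n) (hW i i.lt_succ_self n)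

theorem stronglyMeasurable_enksForecast [MeasurableSpace Ω] (N i : ℕ)
    (h0 : ∀ n, StronglyMeasurable (ξ.init n))
    (hV : ∀ j < i + 1, ∀ n, StronglyMeasurable (ξ.model (j + 1) n))
    (hW : ∀ j < i, ∀ n, StronglyMeasurable (ξ.obs (j + 1) n)) (n : Fin N) :
    StronglyMeasurable fun ω => enksForecast S ξ N i ω n :=
  S.stronglyMeasurable_advance i
    (stronglyMeasurable_enks S ξ N i h0 (fun j hj => hV j (by omega)) hW n)
    (hV i i.lt_succ_self n)

/-- Only inputs of member `n` are involved, which is the source of independence between members. The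
σ-algebra on Ω is left free for that purpose. -/
theorem stronglyMeasurable_fixedGainEnsemble [MeasurableSpace Ω]
    (C : ∀ i, Matrix (Fin (i + 1) × Fin m) (Fin (i + 1) × Fin m) ℝ) (i n : ℕ)
    (h0 : StronglyMeasurable (ξ.init n))
    (hV : ∀ j < i, StronglyMeasurable (ξ.model (j + 1) n))
    (hW : ∀ j < i, StronglyMeasurable (ξ.obs (j + 1) n)) :
    StronglyMeasurable (fixedGainEnsemble S ξ C i n) := by
  induction i with
  | zero => exact continuous_compositeZero.comp_stronglyMeasurable h0
  | succ i ih =>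
    exact S.stronglyMeasurable_analysis (i + 1) stronglyMeasurable_const
      (S.stronglyMeasurable_advance i (ih (fun j hj => hV j (by omega)) fun j hj => hW j (by omega))
        (hV i i.lt_succ_self)) (hW i i.lt_succ_self)

theorem stronglyMeasurable_coordinate (k : ℕ) (j : InputIndex k) :
    StronglyMeasurable fun x : ∀ j : InputIndex k, EuclideanSpace ℝ (Fin (j.dim m o)) => x j :=
  (measurable_pi_apply j).stronglyMeasurable

theorem stronglyMeasurable_coordinateInputs_model (k i n : ℕ) :
    StronglyMeasurable ((coordinateInputs m o k).model (i + 1) n) := by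
  by_cases h : i < k
  · have e : (coordinateInputs m o k).model (i + 1) n = fun x => x (.model ⟨i, h⟩ n) :=
      funext fun _ => dif_pos h
    rw [e]
    exact stronglyMeasurable_coordinate k (.model ⟨i, h⟩ n)
  · have e : (coordinateInputs m o k).model (i + 1) n = fun _ => 0 := funext fun _ => dif_neg h
    rw [e]
    exact stronglyMeasurable_const

theorem stronglyMeasurable_coordinateInputs_obs (k i n : ℕ) :
    StronglyMeasurable ((coordinateInputs m o k).obs (i + 1) n) := by
  by_cases h : i < k
  · have e : (coordinateInputs m o k).obs (i + 1) n = fun x => x (.obs ⟨i, h⟩ n) :=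
      funext fun _ => dif_pos h
    rw [e]
    exact stronglyMeasurable_coordinate k (.obs ⟨i, h⟩ n)
  · have e : (coordinateInputs m o k).obs (i + 1) n = fun _ => 0 := funext fun _ => dif_neg h
    rw [e]
    exact stronglyMeasurable_const

end Measurability

/-! ### Exchangeability. -/

section Exchangeability

variable {Ω : Type*} [MeasurableSpace Ω] {Pr : Measure Ω} {m : ℕ} {o : ℕ → ℕ} {k : ℕ}
  {S : LinearSystem m o} {ξ : RandomInputs Ω m o}

instance (k : ℕ) : Countable (InputIndex k) := by
  let f : InputIndex k → ℕ ⊕ (Fin k × ℕ) ⊕ (Fin k × ℕ)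
    | .init n => .inl n
    | .model i n => .inr (.inl (i, n))
    | .obs i n => .inr (.inr (i, n))
  refine Function.Injective.countable (f := f) ?_
  rintro (n | ⟨i, n⟩ | ⟨i, n⟩) (n' | ⟨i', n'⟩ | ⟨i', n'⟩) h <;> simp_all [f]

/-- Renumbering of the labels of the inputs. -/
def InputIndex.map (f : ℕ → ℕ) : InputIndex k → InputIndex k
  | .init n => .init (f n)
  | .model i n => .model i (f n)
  | .obs i n => .obs i (f n)

theorem InputIndex.map_injective {f : ℕ → ℕ} (hf : f.Injective) :
    (InputIndex.map f : InputIndex k → InputIndex k).Injective := by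
  rintro (n | ⟨i, n⟩ | ⟨i, n⟩) (n' | ⟨i', n'⟩ | ⟨i', n'⟩) h <;>
    simp_all [InputIndex.map, hf.eq_iff]

theorem RandomInputs.IsSampleOf.reindex (h : ξ.IsSampleOf S k Pr) {f : ℕ → ℕ}
    (hf : f.Injective) : (ξ.reindex f).IsSampleOf S k Pr where
  indep := by
    have h1 := (h.indep.precomp (InputIndex.map_injective (k := k) hf)).iIndep
    -- The spaces of the inputs `j` and `j.map f` agree only after a case distinction, so
    -- independence is transported through the generated σ-algebras.
    have e : (fun j : InputIndex k => MeasurableSpace.comap ((ξ.reindex f).family k j)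
        (inferInstance : MeasurableSpace (EuclideanSpace ℝ (Fin (j.dim m o))))) =
        fun j : InputIndex k => MeasurableSpace.comap (ξ.family k (j.map f)) inferInstance := by
      ext1 j
      cases j <;> rfl
    rw [iIndepFun_iff_iIndep, e]
    exact h1
  law_init n := h.law_init (f n)
  law_model i h1 h2 n := h.law_model i h1 h2 (f n)
  law_obs i h1 h2 n := h.law_obs i h1 h2 (f n)

/-- By independence, the marginal laws determine the joint law. -/
theorem RandomInputs.IsSampleOf.identDistrib_family [IsProbabilityMeasure Pr]
    {ξ' : RandomInputs Ω m o}
    (h : ξ.IsSampleOf S k Pr) (h' : ξ'.IsSampleOf S k Pr) :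
    IdentDistrib (fun ω j => ξ.family k j ω) (fun ω j => ξ'.family k j ω) Pr Pr := by
  refine IdentDistrib.pi (fun j => ?_) h.indep h'.indep
  cases j with
  | init n => exact (h.law_init n).identDistrib (h'.law_init n)
  | model i n =>
    exact (h.law_model (i + 1) (by omega) i.2 n).identDistrib
      (h'.law_model (i + 1) (by omega) i.2 n)
  | obs i n =>
    exact (h.law_obs (i + 1) (by omega) i.2 n).identDistrib (h'.law_obs (i + 1) (by omega) i.2 n)

/-- A family is exchangeable if it is a measurable function of the inputs in such a way that
renumbering the inputs renumbers the family. -/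
theorem RandomInputs.IsSampleOf.exchangeable_of [IsProbabilityMeasure Pr]
    (h : ξ.IsSampleOf S k Pr) {N : ℕ} {E : Type*} [MeasurableSpace E] {Y : Fin N → Ω → E}
    {Φ : (∀ j : InputIndex k, EuclideanSpace ℝ (Fin (j.dim m o))) → Fin N → E}
    (hΦ : ∀ n, Measurable fun x => Φ x n)
    (hY : ∀ (π : Equiv.Perm (Fin N)) (f : ℕ → ℕ), (∀ n : Fin N, f n = π n) →
      ∀ n ω, Y (π n) ω = Φ (fun j => (ξ.reindex f).family k j ω) n) :
    Exchangeable Y Pr := by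
  intro π
  -- The permutation is extended to all of ℕ, as the input family contains infinitely many members.
  set f : ℕ → ℕ := ⇑(π.viaFintypeEmbedding Fin.valEmbedding)
  have hfn : ∀ n : Fin N, f n = π n := fun n =>
    Equiv.Perm.viaFintypeEmbedding_apply_image π Fin.valEmbedding n
  have e1 : (fun ω n => Y n ω) = fun ω => Φ fun j => (ξ.reindex id).family k j ω :=
    funext fun ω => funext fun n => hY 1 id (fun _ => rfl) n ω
  have e2 : (fun ω n => Y (π n) ω) = fun ω => Φ fun j => (ξ.reindex f).family k j ω :=
    funext fun ω => funext fun n => hY π f hfn n ω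
  rw [e1, e2]
  exact ((h.reindex (Equiv.injective _)).identDistrib_family
    (h.reindex Function.injective_id)).comp (measurable_pi_lambda _ hΦ)

theorem RandomInputs.IsSampleOf.exchangeable [IsProbabilityMeasure Pr] (h : ξ.IsSampleOf S k Pr)
    {i : ℕ} (hi : i ≤ k) (N : ℕ) :
    Exchangeable (fun (n : Fin N) ω => (enks S ξ N i ω n, refEnsemble S ξ Pr i n ω)) Pr := by
  -- Fixed once from the original numbering, so that one function of the inputs serves all
  -- permutations.
  set C := refForecastCov S ξ Pr
  refine h.exchangeable_of (Φ := fun x n => (enks S (coordinateInputs m o k) N i x n,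
    fixedGainEnsemble S (coordinateInputs m o k) C i n x)) (fun n => Measurable.prodMk ?_ ?_) ?_
  · exact (stronglyMeasurable_enks S _ N i (fun n => stronglyMeasurable_coordinate k (.init n))
      (fun j _ => stronglyMeasurable_coordinateInputs_model k j)
      (fun j _ => stronglyMeasurable_coordinateInputs_obs k j) n).measurable
  · exact (stronglyMeasurable_fixedGainEnsemble S _ C i n
      (stronglyMeasurable_coordinate k (.init n))
      (fun j _ => stronglyMeasurable_coordinateInputs_model k j n)
      (fun j _ => stronglyMeasurable_coordinateInputs_obs k j n)).measurable
  · intro π f hf n ω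
    rw [← enks_reindex S ξ π hf, enks_eq_coordinateInputs S (ξ.reindex f) hi,
      refEnsemble_eq_fixedGainEnsemble, ← hf, ← fixedGainEnsemble_reindex,
      fixedGainEnsemble_eq_coordinateInputs S (ξ.reindex f) C hi]

theorem RandomInputs.IsSampleOf.exchangeable_forecast [IsProbabilityMeasure Pr]
    (h : ξ.IsSampleOf S k Pr) {i : ℕ} (hi : i < k) (N : ℕ) :
    Exchangeable (fun (n : Fin N) ω => (enksForecast S ξ N i ω n, refForecast S ξ Pr i n ω)) Pr := by
  set C := refForecastCov S ξ Pr
  refine h.exchangeable_of (Φ := fun x n => (enksForecast S (coordinateInputs m o k) N i x n,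
    S.advance i (fixedGainEnsemble S (coordinateInputs m o k) C i n x)
      ((coordinateInputs m o k).model (i + 1) n x))) (fun n => Measurable.prodMk ?_ ?_) ?_
  · exact (stronglyMeasurable_enksForecast S _ N i
      (fun n => stronglyMeasurable_coordinate k (.init n))
      (fun j _ => stronglyMeasurable_coordinateInputs_model k j)
      (fun j _ => stronglyMeasurable_coordinateInputs_obs k j) n).measurable
  · exact (S.stronglyMeasurable_advance i (stronglyMeasurable_fixedGainEnsemble S _ C i n
      (stronglyMeasurable_coordinate k (.init n))
      (fun j _ => stronglyMeasurable_coordinateInputs_model k j n)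
      (fun j _ => stronglyMeasurable_coordinateInputs_obs k j n))
      (stronglyMeasurable_coordinateInputs_model k i n)).measurable
  · intro π f hf n ω
    simp only [enksForecast, refForecast]
    rw [coordinateInputs_model (ξ.reindex f) hi, ← enks_eq_coordinateInputs S (ξ.reindex f) hi.le,
      enks_reindex S ξ π hf, refEnsemble_eq_fixedGainEnsemble,
      ← fixedGainEnsemble_eq_coordinateInputs S (ξ.reindex f) C hi.le, fixedGainEnsemble_reindex,
      ← hf]
    rfl

theorem Exchangeable.identDistrib {E : Type*} [MeasurableSpace E] {N : ℕ} {Y : Fin N → Ω → E}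
    (h : Exchangeable Y Pr) (n n' : Fin N) : IdentDistrib (Y n) (Y n') Pr Pr := by
  have := (h (Equiv.swap n n')).comp (measurable_pi_apply n')
  simpa [Function.comp_def] using this

/-- Exchangeability for an ensemble of `n + 1` members, of which member `n` is the last; the
reference component does not depend on the ensemble size. -/
theorem RandomInputs.IsSampleOf.identDistrib_refEnsemble [IsProbabilityMeasure Pr]
    (h : ξ.IsSampleOf S k Pr) {i : ℕ} (hi : i ≤ k) (n : ℕ) :
    IdentDistrib (refEnsemble S ξ Pr i n) (refEnsemble S ξ Pr i 0) Pr Pr :=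
  ((h.exchangeable hi (n + 1)).identDistrib (Fin.last n) 0).comp measurable_snd

theorem RandomInputs.IsSampleOf.identDistrib_refForecast [IsProbabilityMeasure Pr]
    (h : ξ.IsSampleOf S k Pr) {i : ℕ} (hi : i < k) (n : ℕ) :
    IdentDistrib (refForecast S ξ Pr i n) (refForecast S ξ Pr i 0) Pr Pr :=
  ((h.exchangeable_forecast hi (n + 1)).identDistrib (Fin.last n) 0).comp measurable_snd

end Exchangeability
-- Independence of reference members and of fresh perturbations.
section Independence

variable {Ω : Type*} [MeasurableSpace Ω] {Pr : Measure Ω} {m : ℕ} {o : ℕ → ℕ} {k : ℕ}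
  {S : LinearSystem m o} {ξ : RandomInputs Ω m o}

/-- The member to which an input belongs. -/
def InputIndex.member : InputIndex k → ℕ
  | .init n => n
  | .model _ n => n
  | .obs _ n => n

/-- The time at which an input enters. -/
def InputIndex.time : InputIndex k → ℕ
  | .init _ => 0
  | .model i _ => i + 1
  | .obs i _ => i + 1

/-- The inputs of member `n` up to time `i`. -/
def pastInputs (k n i : ℕ) : Set (InputIndex k) := {j | j.member = n ∧ j.time ≤ i}

/-- The `σ`-algebra generated by the inputs with labels in `T`. -/
abbrev RandomInputs.sigmaAlgebra (ξ : RandomInputs Ω m o) (T : Set (InputIndex k)) :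
    MeasurableSpace Ω :=
  ⨆ j ∈ T, MeasurableSpace.comap (ξ.family k j) inferInstance

omit [MeasurableSpace Ω] in
theorem RandomInputs.stronglyMeasurable_family {T : Set (InputIndex k)} {j : InputIndex k}
    (hj : j ∈ T) : StronglyMeasurable[ξ.sigmaAlgebra T] (ξ.family k j) := by
  have h : Measurable[ξ.sigmaAlgebra T] (ξ.family k j) :=
    Measurable.mono (comap_measurable (ξ.family k j))
      (le_iSup₂ (f := fun j (_ : j ∈ T) => MeasurableSpace.comap (ξ.family k j) inferInstance) j hj)
      le_rfl
  exact h.stronglyMeasurable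

theorem RandomInputs.indepFun (hξ : iIndepFun (ξ.family k) Pr)
    (hm : ∀ j, Measurable (ξ.family k j)) {T T' : Set (InputIndex k)} (hT : Disjoint T T')
    {E F : Type*} [MeasurableSpace E] [MeasurableSpace F] {f : Ω → E} {g : Ω → F}
    (hf : Measurable[ξ.sigmaAlgebra T] f) (hg : Measurable[ξ.sigmaAlgebra T'] g) : f ⟂ᵢ[Pr] g := by
  rw [IndepFun_iff_Indep]
  have h := indep_iSup_of_disjoint (fun j => (hm j).comap_le) hξ.iIndep hT
  exact indep_of_indep_of_le_left (indep_of_indep_of_le_right h hg.comap_le) hf.comap_le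

variable (S ξ Pr)

theorem stronglyMeasurable_refEnsemble {i : ℕ} (hi : i ≤ k) (n : ℕ) {T : Set (InputIndex k)}
    (hT : pastInputs k n i ⊆ T) :
    StronglyMeasurable[ξ.sigmaAlgebra T] (refEnsemble S ξ Pr i n) := by
  have e : refEnsemble S ξ Pr i n = fixedGainEnsemble S ξ (refForecastCov S ξ Pr) i n :=
    funext fun ω => refEnsemble_eq_fixedGainEnsemble S ξ Pr i n ω
  rw [e]
  refine @stronglyMeasurable_fixedGainEnsemble Ω m o S ξ (ξ.sigmaAlgebra T) _ i n ?_
    (fun j hj => ?_) fun j hj => ?_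
  · exact ξ.stronglyMeasurable_family (j := .init n) (hT ⟨rfl, Nat.zero_le i⟩)
  · exact ξ.stronglyMeasurable_family (j := .model ⟨j, by omega⟩ n) (hT ⟨rfl, hj⟩)
  · exact ξ.stronglyMeasurable_family (j := .obs ⟨j, by omega⟩ n) (hT ⟨rfl, hj⟩)

theorem stronglyMeasurable_refForecast {i : ℕ} (hi : i < k) (n : ℕ) {T : Set (InputIndex k)}
    (hT : pastInputs k n i ⊆ T) (hT' : .model ⟨i, hi⟩ n ∈ T) :
    StronglyMeasurable[ξ.sigmaAlgebra T] (refForecast S ξ Pr i n) :=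
  @LinearSystem.stronglyMeasurable_advance m o S Ω (ξ.sigmaAlgebra T) i _ _
    (stronglyMeasurable_refEnsemble Pr S ξ hi.le n hT) (ξ.stronglyMeasurable_family hT')

variable {S ξ Pr}

theorem RandomInputs.IsSampleOf.indepFun_refEnsemble (h : ξ.IsSampleOf S k Pr)
    (hm : ∀ j, Measurable (ξ.family k j)) {i : ℕ} (hi : i ≤ k) {n n' : ℕ} (hn : n ≠ n') :
    refEnsemble S ξ Pr i n ⟂ᵢ[Pr] refEnsemble S ξ Pr i n' :=
  RandomInputs.indepFun h.indep hm (T := pastInputs k n i) (T' := pastInputs k n' i)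
    (Set.disjoint_left.2 fun _ hj hj' => hn (hj.1.symm.trans hj'.1))
    (stronglyMeasurable_refEnsemble Pr S ξ hi n subset_rfl).measurable
    (stronglyMeasurable_refEnsemble Pr S ξ hi n' subset_rfl).measurable

theorem RandomInputs.IsSampleOf.indepFun_refForecast (h : ξ.IsSampleOf S k Pr)
    (hm : ∀ j, Measurable (ξ.family k j)) {i : ℕ} (hi : i < k) {n n' : ℕ} (hn : n ≠ n') :
    refForecast S ξ Pr i n ⟂ᵢ[Pr] refForecast S ξ Pr i n' :=
  RandomInputs.indepFun h.indep hm (T := {j | j.member = n}) (T' := {j | j.member = n'})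
    (Set.disjoint_left.2 fun _ hj hj' => hn (hj.symm.trans hj'))
    (stronglyMeasurable_refForecast Pr S ξ hi n (fun _ hj => hj.1) rfl).measurable
    (stronglyMeasurable_refForecast Pr S ξ hi n' (fun _ hj => hj.1) rfl).measurable

omit [MeasurableSpace Ω] in
theorem RandomInputs.measurable_family_singleton (ξ : RandomInputs Ω m o) (j : InputIndex k) :
    Measurable[ξ.sigmaAlgebra {j}] (ξ.family k j) :=
  (ξ.stronglyMeasurable_family (Set.mem_singleton j)).measurable

theorem RandomInputs.IsSampleOf.indepFun_refEnsemble_model (h : ξ.IsSampleOf S k Pr)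
    (hm : ∀ j, Measurable (ξ.family k j)) {i : ℕ} (hi : i < k) (n : ℕ) :
    refEnsemble S ξ Pr i n ⟂ᵢ[Pr] ξ.model (i + 1) n := by
  -- The model perturbation enters at time `i + 1`, later than all past inputs.
  have hd : Disjoint (pastInputs k n i) {.model ⟨i, hi⟩ n} := by
    simp [pastInputs, InputIndex.time]
  have hU : Measurable[ξ.sigmaAlgebra (pastInputs k n i)] (refEnsemble S ξ Pr i n) :=
    (stronglyMeasurable_refEnsemble Pr S ξ hi.le n subset_rfl).measurable
  have h' : refEnsemble S ξ Pr i n ⟂ᵢ[Pr] ξ.family k (.model ⟨i, hi⟩ n) :=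
    RandomInputs.indepFun h.indep hm hd hU (ξ.measurable_family_singleton _)
  exact h'

theorem RandomInputs.IsSampleOf.indepFun_refForecast_obs (h : ξ.IsSampleOf S k Pr)
    (hm : ∀ j, Measurable (ξ.family k j)) {i : ℕ} (hi : i < k) (n : ℕ) :
    refForecast S ξ Pr i n ⟂ᵢ[Pr] ξ.obs (i + 1) n := by
  have hd : Disjoint (insert (.model ⟨i, hi⟩ n) (pastInputs k n i)) {.obs ⟨i, hi⟩ n} := by
    simp [pastInputs, InputIndex.time]
  have hU : Measurable[ξ.sigmaAlgebra (insert (.model ⟨i, hi⟩ n) (pastInputs k n i))]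
      (refForecast S ξ Pr i n) :=
    (stronglyMeasurable_refForecast Pr S ξ hi n (Set.subset_insert _ _)
      (Set.mem_insert _ _)).measurable
  have h' : refForecast S ξ Pr i n ⟂ᵢ[Pr] ξ.family k (.obs ⟨i, hi⟩ n) :=
    RandomInputs.indepFun h.indep hm hd hU (ξ.measurable_family_singleton _)
  exact h'

end Independence

/-! ### Moments of affine functions of independent vectors. -/

section AffineMoments

variable {Ω : Type*} [MeasurableSpace Ω] {Pr : Measure Ω} [IsProbabilityMeasure Pr]
  {ι κ l : Type*} [Fintype ι] [Fintype κ] [Fintype l] [DecidableEq ι] [DecidableEq κ]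

omit [IsProbabilityMeasure Pr] in
theorem MeasureTheory.MemLp.toEuclideanLin_apply {X : Ω → EuclideanSpace ℝ ι} {p : ℝ≥0∞}
    (hX : MemLp X p Pr) (A : Matrix l ι ℝ) : MemLp (fun ω => A.toEuclideanLin (X ω)) p Pr :=
  (matrixAction l ι A).comp_memLp' hX

theorem MeasureTheory.MemLp.affine {X : Ω → EuclideanSpace ℝ ι} {V : Ω → EuclideanSpace ℝ κ}
    {p : ℝ≥0∞} (hX : MemLp X p Pr) (hV : MemLp V p Pr) (A : Matrix l ι ℝ) (B : Matrix l κ ℝ)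
    (c : EuclideanSpace ℝ l) :
    MemLp (fun ω => A.toEuclideanLin (X ω) + B.toEuclideanLin (V ω) + c) p Pr := by
  have h : MemLp (fun ω => A.toEuclideanLin (X ω) + B.toEuclideanLin (V ω)) p Pr :=
    (hX.toEuclideanLin_apply A).add (hV.toEuclideanLin_apply B)
  exact h.add (memLp_const c)

omit [IsProbabilityMeasure Pr] [DecidableEq ι] in
theorem MeasureTheory.MemLp.euclidean_apply {X : Ω → EuclideanSpace ℝ ι} {p : ℝ≥0∞}
    (hX : MemLp X p Pr) (a : ι) : MemLp (fun ω => X ω a) p Pr :=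
  (EuclideanSpace.proj (𝕜 := ℝ) a).comp_memLp' hX

omit [Fintype l] in
theorem covarianceMatrix_toEuclideanLin {X : Ω → EuclideanSpace ℝ ι} (hX : MemLp X 2 Pr)
    (A : Matrix l ι ℝ) : covarianceMatrix Pr (fun ω => A.toEuclideanLin (X ω)) =
      A * covarianceMatrix Pr X * Aᵀ := by
  ext a b
  have h : ∀ c i, MemLp (fun ω => A c i * X ω i) 2 Pr := fun c i =>
    (hX.euclidean_apply i).const_mul _
  simp only [covarianceMatrix, Matrix.of_apply, Matrix.toLpLin_apply, Matrix.mulVec, dotProduct]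
  rw [covariance_fun_sum_fun_sum (h a) (h b)]
  simp only [covariance_const_mul_left, covariance_const_mul_right, Matrix.mul_apply,
    Matrix.transpose_apply, Finset.sum_mul, Matrix.of_apply]
  rw [Finset.sum_comm]
  refine Finset.sum_congr rfl fun i _ => Finset.sum_congr rfl fun j _ => ?_
  ring

omit [DecidableEq ι] in
theorem ProbabilityTheory.IndepFun.covarianceMatrix_add {X Y : Ω → EuclideanSpace ℝ ι}
    (h : X ⟂ᵢ[Pr] Y) (hX : MemLp X 2 Pr) (hY : MemLp Y 2 Pr) :
    covarianceMatrix Pr (fun ω => X ω + Y ω) = covarianceMatrix Pr X + covarianceMatrix Pr Y := by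
  have coord : ∀ a : ι, Measurable fun x : EuclideanSpace ℝ ι => x a := fun a =>
    (EuclideanSpace.proj (𝕜 := ℝ) a).continuous.measurable
  ext a b
  have h1 := (h.comp (coord a) (coord b)).covariance_eq_zero (hX.euclidean_apply a)
    (hY.euclidean_apply b)
  have h2 := (h.symm.comp (coord a) (coord b)).covariance_eq_zero (hY.euclidean_apply a)
    (hX.euclidean_apply b)
  have e := covariance_add_left (hX.euclidean_apply a) (hY.euclidean_apply a)
    ((hX.euclidean_apply b).add (hY.euclidean_apply b))
  rw [covariance_add_right (hX.euclidean_apply a) (hX.euclidean_apply b) (hY.euclidean_apply b),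
    covariance_add_right (hY.euclidean_apply a) (hX.euclidean_apply b) (hY.euclidean_apply b)] at e
  simp only [Function.comp_def] at h1 h2
  rw [h1, h2, add_zero, zero_add] at e
  exact e

omit [DecidableEq ι] in
theorem covarianceMatrix_add_const {X : Ω → EuclideanSpace ℝ ι} (hX : MemLp X 2 Pr)
    (c : EuclideanSpace ℝ ι) :
    covarianceMatrix Pr (fun ω => X ω + c) = covarianceMatrix Pr X := by
  have hi : ∀ a, Integrable (fun ω => X ω a) Pr := fun a =>
    (hX.euclidean_apply a).integrable one_le_two
  ext a b
  simp only [covarianceMatrix, Matrix.of_apply, PiLp.add_apply]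
  rw [covariance_add_const_left (hi a), covariance_add_const_right (hi b)]

/-- The covariance of an affine function of two independent random vectors. -/
theorem ProbabilityTheory.IndepFun.covarianceMatrix_affine {X : Ω → EuclideanSpace ℝ ι}
    {V : Ω → EuclideanSpace ℝ κ} (h : X ⟂ᵢ[Pr] V) (hX : MemLp X 2 Pr) (hV : MemLp V 2 Pr)
    (A : Matrix l ι ℝ) (B : Matrix l κ ℝ) (c : EuclideanSpace ℝ l) :
    covarianceMatrix Pr (fun ω => A.toEuclideanLin (X ω) + B.toEuclideanLin (V ω) + c) =
      A * covarianceMatrix Pr X * Aᵀ + B * covarianceMatrix Pr V * Bᵀ := by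
  have hA := hX.toEuclideanLin_apply A
  have hB := hV.toEuclideanLin_apply B
  have hi := h.comp (matrixAction l ι A).continuous.measurable
    (matrixAction l κ B).continuous.measurable
  rw [covarianceMatrix_add_const (X := fun ω => A.toEuclideanLin (X ω) + B.toEuclideanLin (V ω))
    (hA.add hB), ← covarianceMatrix_toEuclideanLin hX, ← covarianceMatrix_toEuclideanLin hV]
  exact hi.covarianceMatrix_add hA hB

theorem integral_affine {X : Ω → EuclideanSpace ℝ ι}
    {V : Ω → EuclideanSpace ℝ κ} (hX : Integrable X Pr) (hV : Integrable V Pr)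
    (A : Matrix l ι ℝ) (B : Matrix l κ ℝ) (c : EuclideanSpace ℝ l) :
    ∫ ω, A.toEuclideanLin (X ω) + B.toEuclideanLin (V ω) + c ∂Pr =
      A.toEuclideanLin (∫ ω, X ω ∂Pr) + B.toEuclideanLin (∫ ω, V ω ∂Pr) + c := by
  have hA : Integrable (fun ω => A.toEuclideanLin (X ω)) Pr :=
    (matrixAction l ι A).integrable_comp hX
  have hB : Integrable (fun ω => B.toEuclideanLin (V ω)) Pr :=
    (matrixAction l κ B).integrable_comp hV
  rw [integral_add (f := fun ω => A.toEuclideanLin (X ω) + B.toEuclideanLin (V ω)) (hA.add hB)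
    (integrable_const c), integral_add hA hB, integral_const]
  have h1 := (matrixAction l ι A).integral_comp_comm hX
  have h2 := (matrixAction l κ B).integral_comp_comm hV
  simp only [matrixAction_apply] at h1 h2
  rw [h1, h2]
  simp

omit [DecidableEq ι] in
-- The quadratic form at x is the variance of ⟨x, X⟩, obtained by applying the one-row matrix x to
-- X.
theorem covarianceMatrix_posSemidef {X : Ω → EuclideanSpace ℝ ι} (hX : MemLp X 2 Pr) :
    (covarianceMatrix Pr X).PosSemidef := by
  classical
  refine Matrix.PosSemidef.of_dotProduct_mulVec_nonneg ?_ fun x => ?_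
  · ext a b
    simp [covarianceMatrix, covariance_comm]
  · have h := congrFun (congrFun
      (covarianceMatrix_toEuclideanLin hX (Matrix.of fun (_ : Unit) => x)) ()) ()
    have e : star x ⬝ᵥ covarianceMatrix Pr X *ᵥ x =
        (Matrix.of (fun (_ : Unit) => x) * covarianceMatrix Pr X *
          (Matrix.of fun (_ : Unit) => x)ᵀ) () () := by
      rw [Matrix.mul_assoc]
      simp [Matrix.mul_apply, dotProduct, Matrix.mulVec]
    rw [e, ← h]
    simp only [covarianceMatrix, Matrix.of_apply]
    rw [covariance_self]
    · exact variance_nonneg _ _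
    · exact ((hX.toEuclideanLin_apply _).euclidean_apply ()).1.aemeasurable

omit [IsProbabilityMeasure Pr] in
theorem ProbabilityTheory.HasLaw.memLp_of_gaussian {X : Ω → EuclideanSpace ℝ ι}
    {μ : EuclideanSpace ℝ ι} {A : Matrix ι ι ℝ} (h : HasLaw X (multivariateGaussian μ A) Pr)
    {p : ℝ≥0∞} (hp : p ≠ ∞) : MemLp X p Pr := by
  have h1 : MemLp id p (Pr.map X) := by
    rw [h.map_eq]
    exact IsGaussian.memLp_id _ p hp
  exact (memLp_map_measure_iff h1.1 h.aemeasurable).1 h1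

omit [IsProbabilityMeasure Pr] in
theorem ProbabilityTheory.HasLaw.covarianceMatrix_of_gaussian {X : Ω → EuclideanSpace ℝ ι}
    {μ : EuclideanSpace ℝ ι} {A : Matrix ι ι ℝ} (h : HasLaw X (multivariateGaussian μ A) Pr)
    (hA : A.PosSemidef) : covarianceMatrix Pr X = A := by
  have coord : ∀ a : ι, Measurable fun x : EuclideanSpace ℝ ι => x a := fun a =>
    (EuclideanSpace.proj (𝕜 := ℝ) a).continuous.measurable
  ext a b
  rw [← covariance_eval_multivariateGaussian (μ := μ) hA a b]
  exact h.covariance_fun_comp (coord a).aemeasurable (coord b).aemeasurable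

omit [IsProbabilityMeasure Pr] in
theorem ProbabilityTheory.HasLaw.integral_of_gaussian {X : Ω → EuclideanSpace ℝ ι}
    {μ : EuclideanSpace ℝ ι} {A : Matrix ι ι ℝ} (h : HasLaw X (multivariateGaussian μ A) Pr) :
    ∫ ω, X ω ∂Pr = μ := by
  rw [h.integral_eq, integral_id_multivariateGaussian]

end AffineMoments

/-! ### Moments of the reference ensemble and the Kalman smoother. -/

section SmootherMoments

namespace LinearSystem

variable {m : ℕ} {o : ℕ → ℕ} (S : LinearSystem m o)

theorem advance_eq_affine (i : ℕ) (x : Composite m i) (v : EuclideanSpace ℝ (Fin m)) :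
    S.advance i x v = (S.modelMatrix i).toEuclideanLin x + (lastBlock m (i + 1)).toEuclideanLin v +
      (lastBlock m (i + 1)).toEuclideanLin (S.shift (i + 1)) := by
  rw [advance, map_add]
  abel

theorem analysis_eq_affine (i : ℕ) (P : Matrix (Fin (i + 1) × Fin m) (Fin (i + 1) × Fin m) ℝ)
    (x : Composite m i) (w : EuclideanSpace ℝ (Fin (o i))) :
    S.analysis i P x w = (1 - S.gain i P * S.obsMatrix i).toEuclideanLin x +
      (-S.gain i P).toEuclideanLin w + (S.gain i P).toEuclideanLin (S.y i) := by
  have h1 : (1 : Matrix (Fin (i + 1) × Fin m) (Fin (i + 1) × Fin m) ℝ).toEuclideanLin x = x := by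
    simp
  rw [analysis, map_sub (Matrix.toEuclideanLin), LinearMap.sub_apply, h1,
    Matrix.toEuclideanLin_mul_apply, map_neg, LinearMap.neg_apply, map_sub, map_sub]
  abel

/-- The analysis covariance computed with the optimal gain. -/
theorem analysisCov_eq (i : ℕ) (hR : (S.R i).PosDef)
    {P : Matrix (Fin (i + 1) × Fin m) (Fin (i + 1) × Fin m) ℝ} (hP : P.PosSemidef) :
    (1 - S.gain i P * S.obsMatrix i) * P * (1 - S.gain i P * S.obsMatrix i)ᵀ +
      (-S.gain i P) * S.R i * (-S.gain i P)ᵀ = (1 - S.gain i P * S.obsMatrix i) * P := by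
  set H := S.obsMatrix i with hH
  set K := S.gain i P with hK
  have h1 : K * (H * P * Hᵀ + S.R i) = P * Hᵀ := by
    rw [hK, gain, Matrix.mul_assoc, Matrix.nonsing_inv_mul _ (S.isUnit_innovationCov i hR hP),
      Matrix.mul_one]
  -- Optimality of the gain. It turns (I - KH)P(I - KH)ᵀ into (I - KH)P - KRKᵀ, and the last term
  -- cancels the noise contribution.
  have h2 : (1 - K * H) * P * Hᵀ = K * S.R i := by
    rw [Matrix.sub_mul, Matrix.sub_mul, Matrix.one_mul, ← h1, Matrix.mul_add]
    simp only [Matrix.mul_assoc]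
    abel
  rw [Matrix.transpose_sub, Matrix.transpose_mul, Matrix.transpose_one, Matrix.mul_sub,
    Matrix.mul_one, ← Matrix.mul_assoc, h2, Matrix.transpose_neg, Matrix.mul_neg, Matrix.neg_mul,
    Matrix.neg_mul, neg_neg]
  abel

end LinearSystem

variable {Ω : Type*} [MeasurableSpace Ω] {Pr : Measure Ω} [IsProbabilityMeasure Pr]
  {m : ℕ} {o : ℕ → ℕ} {k : ℕ} {S : LinearSystem m o} {ξ : RandomInputs Ω m o}

theorem compositeZero_eq_toEuclideanLin (x : EuclideanSpace ℝ (Fin m)) :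
    compositeZero x = (Matrix.of fun (r : Fin 1 × Fin m) (b : Fin m) =>
      if r.2 = b then (1 : ℝ) else 0).toEuclideanLin x := by
  ext r
  simp [compositeZero, Matrix.toLpLin_apply, Matrix.mulVec, dotProduct]

theorem RandomInputs.IsSampleOf.memLp_refForecast_of (h : ξ.IsSampleOf S k Pr) {i : ℕ} (hi : i < k)
    (n : ℕ) {p : ℝ≥0∞} (hp : p ≠ ∞) (hU : MemLp (refEnsemble S ξ Pr i n) p Pr) :
    MemLp (refForecast S ξ Pr i n) p Pr := by
  have hV := (h.law_model (i + 1) (by omega) hi n).memLp_of_gaussian hp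
  unfold refForecast
  simp only [LinearSystem.advance_eq_affine]
  exact hU.affine hV _ _ _

theorem RandomInputs.IsSampleOf.memLp_refEnsemble (h : ξ.IsSampleOf S k Pr) {i : ℕ} (hi : i ≤ k)
    (n : ℕ) {p : ℝ≥0∞} (hp : p ≠ ∞) : MemLp (refEnsemble S ξ Pr i n) p Pr := by
  induction i with
  | zero =>
    have e : refEnsemble S ξ Pr 0 n = fun ω => _ :=
      funext fun ω => compositeZero_eq_toEuclideanLin (ξ.init n ω)
    rw [e]
    exact ((h.law_init n).memLp_of_gaussian hp).toEuclideanLin_apply _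
  | succ i ih =>
    have hf := h.memLp_refForecast_of hi n hp (ih (by omega))
    have hW := (h.law_obs (i + 1) (by omega) hi n).memLp_of_gaussian hp
    have e : refEnsemble S ξ Pr (i + 1) n = fun ω => _ := funext fun ω =>
      (refEnsemble_succ S ξ Pr i n ω).trans (S.analysis_eq_affine (i + 1) _ _ _)
    rw [e]
    exact hf.affine hW _ _ _

theorem RandomInputs.IsSampleOf.memLp_refForecast (h : ξ.IsSampleOf S k Pr) {i : ℕ} (hi : i < k)
    (n : ℕ) {p : ℝ≥0∞} (hp : p ≠ ∞) : MemLp (refForecast S ξ Pr i n) p Pr :=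
  h.memLp_refForecast_of hi n hp (h.memLp_refEnsemble hi.le n hp)

theorem RandomInputs.IsSampleOf.integral_refEnsemble_succ (h : ξ.IsSampleOf S k Pr) {i : ℕ}
    (hi : i < k) (n : ℕ) : ∫ ω, refEnsemble S ξ Pr (i + 1) n ω ∂Pr =
      S.analysis (i + 1) (covarianceMatrix Pr (refForecast S ξ Pr i 0))
        (S.advance i (∫ ω, refEnsemble S ξ Pr i n ω ∂Pr) 0) 0 := by
  have hV := h.law_model (i + 1) (by omega) hi n
  have hW := h.law_obs (i + 1) (by omega) hi n
  have e1 : ∫ ω, refForecast S ξ Pr i n ω ∂Pr =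
      S.advance i (∫ ω, refEnsemble S ξ Pr i n ω ∂Pr) 0 := by
    simp only [refForecast, LinearSystem.advance_eq_affine]
    rw [integral_affine ((h.memLp_refEnsemble hi.le n ENNReal.one_ne_top).integrable le_rfl)
      ((hV.memLp_of_gaussian ENNReal.one_ne_top).integrable le_rfl), hV.integral_of_gaussian]
  rw [← e1]
  simp only [refEnsemble_succ, LinearSystem.analysis_eq_affine]
  rw [integral_affine ((h.memLp_refForecast hi n ENNReal.one_ne_top).integrable le_rfl)
      ((hW.memLp_of_gaussian ENNReal.one_ne_top).integrable le_rfl), hW.integral_of_gaussian]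

theorem RandomInputs.IsSampleOf.covarianceMatrix_refForecast (h : ξ.IsSampleOf S k Pr)
    (hm : ∀ j, Measurable (ξ.family k j)) {i : ℕ} (hi : i < k) (hQ : (S.Q (i + 1)).PosSemidef)
    (n : ℕ) : covarianceMatrix Pr (refForecast S ξ Pr i n) =
      S.smootherForecastCov i (covarianceMatrix Pr (refEnsemble S ξ Pr i n)) := by
  have hV := h.law_model (i + 1) (by omega) hi n
  have e : refForecast S ξ Pr i n = fun ω => _ :=
    funext fun ω => S.advance_eq_affine i (refEnsemble S ξ Pr i n ω) (ξ.model (i + 1) n ω)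
  rw [e, (h.indepFun_refEnsemble_model hm hi n).covarianceMatrix_affine
    (h.memLp_refEnsemble hi.le n ENNReal.ofNat_ne_top) (hV.memLp_of_gaussian ENNReal.ofNat_ne_top),
    hV.covarianceMatrix_of_gaussian hQ]
  rfl

theorem RandomInputs.IsSampleOf.covarianceMatrix_refEnsemble_succ (h : ξ.IsSampleOf S k Pr)
    (hm : ∀ j, Measurable (ξ.family k j)) {i : ℕ} (hi : i < k) (hR : (S.R (i + 1)).PosDef) :
    covarianceMatrix Pr (refEnsemble S ξ Pr (i + 1) 0) =
      (1 - S.gain (i + 1) (covarianceMatrix Pr (refForecast S ξ Pr i 0)) * S.obsMatrix (i + 1)) *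
        covarianceMatrix Pr (refForecast S ξ Pr i 0) := by
  have hW := h.law_obs (i + 1) (by omega) hi 0
  have hf := h.memLp_refForecast hi 0 ENNReal.ofNat_ne_top (p := 2)
  have e : refEnsemble S ξ Pr (i + 1) 0 = fun ω => _ := funext fun ω =>
      (refEnsemble_succ S ξ Pr i 0 ω).trans (S.analysis_eq_affine (i + 1) _ _ _)
  rw [e, (h.indepFun_refForecast_obs hm hi 0).covarianceMatrix_affine hf
    (hW.memLp_of_gaussian ENNReal.ofNat_ne_top), hW.covarianceMatrix_of_gaussian hR.posSemidef,
    S.analysisCov_eq (i + 1) hR (covarianceMatrix_posSemidef hf)]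

theorem RandomInputs.IsSampleOf.moments_refEnsemble (h : ξ.IsSampleOf S k Pr)
    (hm : ∀ j, Measurable (ξ.family k j)) (hB : S.B.PosSemidef)
    (hQ : ∀ i, 1 ≤ i → i ≤ k → (S.Q i).PosSemidef) (hR : ∀ i, 1 ≤ i → i ≤ k → (S.R i).PosDef)
    {i : ℕ} (hi : i ≤ k) :
    (∫ ω, refEnsemble S ξ Pr i 0 ω ∂Pr) = S.smootherMean i ∧
      covarianceMatrix Pr (refEnsemble S ξ Pr i 0) = S.smootherCov i := by
  induction i with
  | zero =>
    refine ⟨?_, ?_⟩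
    · simp only [refEnsemble, LinearSystem.smootherMean, compositeZero_eq_toEuclideanLin]
      have := (matrixAction _ _ (Matrix.of fun (r : Fin 1 × Fin m) (b : Fin m) =>
        if r.2 = b then (1 : ℝ) else 0)).integral_comp_comm
          (((h.law_init 0).memLp_of_gaussian ENNReal.one_ne_top).integrable le_rfl)
      rw [(h.law_init 0).integral_of_gaussian] at this
      exact this
    · have := (h.law_init 0).covarianceMatrix_of_gaussian hB
      ext a b
      exact congrFun (congrFun this a.2) b.2
  | succ i ih =>
    obtain ⟨h1, h2⟩ := ih (by omega)
    have hc := h.covarianceMatrix_refForecast hm hi (hQ (i + 1) (by omega) hi) 0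
    rw [h2] at hc
    refine ⟨?_, ?_⟩
    · rw [h.integral_refEnsemble_succ hi, hc, h1]
      rfl
    · rw [h.covarianceMatrix_refEnsemble_succ hm hi (hR (i + 1) (by omega) hi), hc]
      rfl

end SmootherMoments
-- Convergence of the first member.
section Convergence

variable {Ω : Type*} [MeasurableSpace Ω] {Pr : Measure Ω} [IsProbabilityMeasure Pr]
  {m : ℕ} {o : ℕ → ℕ} {k : ℕ} {S : LinearSystem m o} {ξ : RandomInputs Ω m o}

theorem RandomInputs.IsSampleOf.tendsto_gain (h : ξ.IsSampleOf S k Pr)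
    (hm : ∀ j, Measurable (ξ.family k j)) {i : ℕ} (hi : i < k) (hR : (S.R (i + 1)).PosDef)
    (hf : TendstoInAllLp (fun N ω => enksForecast S ξ (N + 2) i ω 0) (refForecast S ξ Pr i 0) Pr) :
    TendstoInAllLp
      (fun N ω => S.gain (i + 1) (sampleCov (enksForecast S ξ (N + 2) i ω)))
      (fun _ => S.gain (i + 1) (covarianceMatrix Pr (refForecast S ξ Pr i 0))) Pr := by
  have hP := TendstoInAllLp.sampleCov
    (A := fun N n ω => enksForecast S ξ (N + 2) i ω n) (u := refForecast S ξ Pr i)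
    (fun N n => (h.exchangeable_forecast hi (N + 2)).identDistrib n 0)
    (fun n n' hn => h.indepFun_refForecast hm hi hn) (h.identDistrib_refForecast hi) hf
  obtain ⟨C, hC⟩ := S.exists_norm_gain_sub_le (i + 1) hR
    (covarianceMatrix_posSemidef (h.memLp_refForecast hi 0 ENNReal.ofNat_ne_top))
  -- The Lipschitz bound applies at every ω, since sample covariances are always positive
  -- semidefinite.
  refine hP.comp_of_norm_sub_le (f := S.gain (i + 1)) (C := C) (fun N => ?_)
    (fun p _ _ => memLp_const _) fun N ω => hC _ (sampleCov_posSemidef _)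
  have hE := stronglyMeasurable_enksForecast S ξ (N + 2) i
    (fun n => (hm (.init n)).stronglyMeasurable)
    (fun j hj n => (hm (.model ⟨j, by omega⟩ n)).stronglyMeasurable)
    (fun j hj n => (hm (.obs ⟨j, by omega⟩ n)).stronglyMeasurable)
  exact (S.stronglyMeasurable_gain (i + 1)
    (MeasureTheory.StronglyMeasurable.sampleCov hE)).aestronglyMeasurable

theorem RandomInputs.IsSampleOf.tendsto_enks (h : ξ.IsSampleOf S k Pr)
    (hm : ∀ j, Measurable (ξ.family k j)) (hR : ∀ i, 1 ≤ i → i ≤ k → (S.R i).PosDef)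
    {i : ℕ} (hi : i ≤ k) :
    TendstoInAllLp (fun N ω => enks S ξ (N + 2) i ω 0) (refEnsemble S ξ Pr i 0) Pr := by
  induction i with
  -- At time 0 the two ensembles coincide for every size.
  | zero => exact TendstoInAllLp.const fun p _ hp => h.memLp_refEnsemble hi 0 hp
  | succ i ih =>
    have hV := h.law_model (i + 1) (by omega) hi 0
    have hW := h.law_obs (i + 1) (by omega) hi 0
    have hV' : ∀ p : ℝ≥0∞, 1 ≤ p → p ≠ ∞ →
        MemLp (fun ω => S.shift (i + 1) + ξ.model (i + 1) 0 ω) p Pr := fun p _ hp =>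
      (memLp_const (S.shift (i + 1))).add (hV.memLp_of_gaussian hp)
    have hW' : ∀ p : ℝ≥0∞, 1 ≤ p → p ≠ ∞ →
        MemLp (fun ω => S.y (i + 1) - ξ.obs (i + 1) 0 ω) p Pr := fun p _ hp =>
      (memLp_const (S.y (i + 1))).sub (hW.memLp_of_gaussian hp)
    have hf : TendstoInAllLp (fun N ω => enksForecast S ξ (N + 2) i ω 0)
        (refForecast S ξ Pr i 0) Pr :=
      ((ih (by omega)).clm (matrixAction _ _ (S.modelMatrix i))).add
        ((TendstoInAllLp.const hV').clm (matrixAction _ _ (LinearSystem.lastBlock m (i + 1))))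
    have hinn : TendstoInAllLp
        (fun N ω => S.y (i + 1) - ξ.obs (i + 1) 0 ω -
          (S.obsMatrix (i + 1)).toEuclideanLin (enksForecast S ξ (N + 2) i ω 0))
        (fun ω => S.y (i + 1) - ξ.obs (i + 1) 0 ω -
          (S.obsMatrix (i + 1)).toEuclideanLin (refForecast S ξ Pr i 0 ω)) Pr :=
      (TendstoInAllLp.const hW').sub
        (hf.clm (matrixAction _ _ (S.obsMatrix (i + 1))))
    exact hf.add ((h.tendsto_gain hm hi (hR (i + 1) (by omega) hi) hf).bilin hinn
      (matrixAction _ _))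

end Convergence

/-! ### Replacing the inputs by measurable versions. -/

section Modification

variable {Ω : Type*} [MeasurableSpace Ω] {Pr : Measure Ω}
  {m : ℕ} {o : ℕ → ℕ} {k : ℕ} {S : LinearSystem m o} {ξ ξ' : RandomInputs Ω m o}

open scoped Classical in
/-- A measurable function which agrees almost everywhere with a given one where possible. -/
noncomputable def measurableModification {E : Type*} [MeasurableSpace E] [Zero E] (Pr : Measure Ω) (f : Ω → E) :
    Ω → E :=
  -- The default covers inputs outside the times up to `k`, about which nothing is known.
  if h : AEMeasurable f Pr then h.mk f else 0

theorem measurable_measurableModification {E : Type*} [MeasurableSpace E] [Zero E]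
    (Pr : Measure Ω) (f : Ω → E) : Measurable (measurableModification Pr f) := by
  unfold measurableModification
  split_ifs with h
  · exact h.measurable_mk
  · exact measurable_const

theorem AEMeasurable.ae_eq_measurableModification {E : Type*} [MeasurableSpace E] [Zero E]
    {f : Ω → E} (h : AEMeasurable f Pr) : f =ᵐ[Pr] measurableModification Pr f := by
  rw [measurableModification, dif_pos h]
  exact h.ae_eq_mk

/-- Measurable versions of all inputs. -/
noncomputable def RandomInputs.modification (ξ : RandomInputs Ω m o) (Pr : Measure Ω) : RandomInputs Ω m o where
  init n := measurableModification Pr (ξ.init n)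
  model i n := measurableModification Pr (ξ.model i n)
  obs i n := measurableModification Pr (ξ.obs i n)

theorem RandomInputs.measurable_family_modification (ξ : RandomInputs Ω m o) (j : InputIndex k) :
    Measurable ((ξ.modification Pr).family k j) := by
  cases j <;> exact measurable_measurableModification _ _

theorem RandomInputs.IsSampleOf.family_ae_eq_modification (h : ξ.IsSampleOf S k Pr)
    (j : InputIndex k) : ξ.family k j =ᵐ[Pr] (ξ.modification Pr).family k j := by
  cases j with
  | init n => exact (h.law_init n).aemeasurable.ae_eq_measurableModification
  | model i n =>
    exact (h.law_model (i + 1) (by omega) i.2 n).aemeasurable.ae_eq_measurableModification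
  | obs i n =>
    exact (h.law_obs (i + 1) (by omega) i.2 n).aemeasurable.ae_eq_measurableModification

theorem RandomInputs.IsSampleOf.congr_ae (h : ξ.IsSampleOf S k Pr)
    (e : ∀ j, ξ.family k j =ᵐ[Pr] ξ'.family k j) : ξ'.IsSampleOf S k Pr where
  indep := h.indep.congr e
  law_init n := (h.law_init n).congr (e (.init n)).symm
  law_model
    | 0, h1, _, _ => absurd h1 (by omega)
    | i + 1, h1, h2, n => (h.law_model (i + 1) h1 h2 n).congr (e (.model ⟨i, h2⟩ n)).symm
  law_obs
    | 0, h1, _, _ => absurd h1 (by omega)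
    | i + 1, h1, h2, n => (h.law_obs (i + 1) h1 h2 n).congr (e (.obs ⟨i, h2⟩ n)).symm

theorem enks_congr_ae (e : ∀ j, ξ.family k j =ᵐ[Pr] ξ'.family k j) {i : ℕ} (hi : i ≤ k) (N : ℕ) :
    enks S ξ N i =ᵐ[Pr] enks S ξ' N i := by
  filter_upwards [ae_all_iff.2 e] with ω hω
  ext1 n
  rw [enks_eq_coordinateInputs S ξ hi, enks_eq_coordinateInputs S ξ' hi, funext hω]

theorem covarianceMatrix_congr_ae {ι : Type*} {X Y : Ω → EuclideanSpace ℝ ι} (h : X =ᵐ[Pr] Y) :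
    covarianceMatrix Pr X = covarianceMatrix Pr Y := by
  have hc : ∀ a, (fun ω => X ω a) =ᵐ[Pr] fun ω => Y ω a := fun a => h.mono fun ω hω => by
    simp only [hω]
  ext a b
  simp only [covarianceMatrix, Matrix.of_apply, covariance]
  rw [integral_congr_ae (hc a), integral_congr_ae (hc b)]
  refine integral_congr_ae (h.mono fun ω hω => ?_)
  simp only [hω]

/-- The gains also depend on the inputs, but only through covariances, which ignore null sets. -/
theorem refEnsemble_congr_ae (e : ∀ j, ξ.family k j =ᵐ[Pr] ξ'.family k j) {i : ℕ} (hi : i ≤ k)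
    (n : ℕ) : refEnsemble S ξ Pr i n =ᵐ[Pr] refEnsemble S ξ' Pr i n := by
  induction i generalizing n with
  | zero =>
    filter_upwards [e (.init n)] with ω hω
    exact congrArg compositeZero hω
  | succ i ih =>
    have hf : ∀ n, refForecast S ξ Pr i n =ᵐ[Pr] refForecast S ξ' Pr i n := by
      intro n
      filter_upwards [ih (by omega) n, e (.model ⟨i, hi⟩ n)] with ω h1 h2
      have h2' : ξ.model (i + 1) n ω = ξ'.model (i + 1) n ω := h2
      rw [refForecast, refForecast, h1, h2']
    filter_upwards [hf n, e (.obs ⟨i, hi⟩ n)] with ω h1 h2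
    have h2' : ξ.obs (i + 1) n ω = ξ'.obs (i + 1) n ω := h2
    rw [refEnsemble_succ, refEnsemble_succ, covarianceMatrix_congr_ae (hf 0), h1, h2']

end Modification

/-- Convergence of the ensemble Kalman smoother. Limits are taken over ensembles with `N + 2`
members, `N → ∞`, so that every sample covariance is well defined. Matrices carry the spectral
norm. -/
theorem mainTheorem1 {Ω : Type*} [MeasurableSpace Ω] (Pr : Measure Ω) [IsProbabilityMeasure Pr]
    (m : ℕ) (o : ℕ → ℕ) (k : ℕ) (S : LinearSystem m o)
    (hB : S.B.PosSemidef)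
    (hQ : ∀ i, 1 ≤ i → i ≤ k → (S.Q i).PosSemidef)
    (hR : ∀ i, 1 ≤ i → i ≤ k → (S.R i).PosDef)
    (ξ : RandomInputs Ω m o) (hξ : ξ.IsSampleOf S k Pr)
    (i : ℕ) (hi : i ≤ k) :
    (∀ N : ℕ, Exchangeable
      (fun (n : Fin N) ω => (enks S ξ N i ω n, refEnsemble S ξ Pr i n ω)) Pr) ∧
    TendstoInAllLp (fun N ω => enks S ξ (N + 2) i ω 0) (refEnsemble S ξ Pr i 0) Pr ∧
    TendstoInAllLp (fun N ω => sampleMean (enks S ξ (N + 2) i ω))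
      (fun _ => ∫ ω, refEnsemble S ξ Pr i 0 ω ∂Pr) Pr ∧
    (∫ ω, refEnsemble S ξ Pr i 0 ω ∂Pr) = S.smootherMean i ∧
    TendstoInAllLp (fun N ω => sampleCov (enks S ξ (N + 2) i ω))
      (fun _ => covarianceMatrix Pr (refEnsemble S ξ Pr i 0)) Pr ∧
    covarianceMatrix Pr (refEnsemble S ξ Pr i 0) = S.smootherCov i := by
  refine ⟨hξ.exchangeable hi, ?_⟩
  -- The laws provide only almost everywhere measurability, while independence through generated
  -- σ-algebras needs measurable inputs. The remaining claims are insensitive to null sets.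
  set ξ' := ξ.modification Pr
  have e : ∀ j : InputIndex k, ξ'.family k j =ᵐ[Pr] ξ.family k j := fun j =>
    (hξ.family_ae_eq_modification j).symm
  have h : ξ'.IsSampleOf S k Pr := hξ.congr_ae hξ.family_ae_eq_modification
  have hm : ∀ j : InputIndex k, Measurable (ξ'.family k j) := ξ.measurable_family_modification
  have hX : ∀ N, enks S ξ' N i =ᵐ[Pr] enks S ξ N i := enks_congr_ae e hi
  have hU := refEnsemble_congr_ae (S := S) e hi 0
  rw [← integral_congr_ae hU, ← covarianceMatrix_congr_ae hU]
  have hconv := h.tendsto_enks hm hR hi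
  have hA : ∀ N (n : Fin (N + 2)), IdentDistrib
      (fun ω => (enks S ξ' (N + 2) i ω n, refEnsemble S ξ' Pr i n ω))
      (fun ω => (enks S ξ' (N + 2) i ω 0, refEnsemble S ξ' Pr i 0 ω)) Pr Pr := fun N n =>
    (h.exchangeable hi (N + 2)).identDistrib n 0
  have hind : Pairwise fun n n' => refEnsemble S ξ' Pr i n ⟂ᵢ[Pr] refEnsemble S ξ' Pr i n' :=
    fun n n' hn => h.indepFun_refEnsemble hm hi hn
  have hid := h.identDistrib_refEnsemble hi
  obtain ⟨hmean, hcov⟩ := h.moments_refEnsemble hm hB hQ hR hi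
  have mean := TendstoInAllLp.sampleMean (A := fun N n ω => enks S ξ' (N + 2) i ω n) hA hind hid hconv
  have cov := TendstoInAllLp.sampleCov (A := fun N n ω => enks S ξ' (N + 2) i ω n) hA hind hid hconv
  refine ⟨hconv.congr_ae (fun N => ?_) hU, mean.congr_ae (fun N => ?_) .rfl, hmean,
    cov.congr_ae (fun N => ?_) .rfl, hcov⟩
  · exact (hX (N + 2)).mono fun ω hω => congrFun hω 0
  · exact (hX (N + 2)).mono fun ω hω => congrArg _root_.sampleMean hω
  · exact (hX (N + 2)).mono fun ω hω => congrArg _root_.sampleCov hω
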